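/- **Setting.** Let $d\ge 0$ be an integer, $\eta=\mathrm{diag}(+,-,\dots,-,+)$ on indices $A=0,\dots,d$, $i\in\{1,2\}$, $\epsilon^{12}=\epsilon_{12}=1$, $a^i=\epsilon^{ij}a_j$, and let $V\in\mathbb R^{d+1}$ with $V^AV_A=1$. Consider the space $\mathbb C[[Z,Y]]$ of formal power series with complex coefficients in the $4(d+1)$ commuting variables $Z^A_i,Y^A_i$. The star product of $f,g\in\mathbb C[[Z,Y]]$ is $$(f*g)(Z,Y)=\frac1{\pi^{2(d+1)}}\int dS\,dT\;e^{-2S^A_iT^i_A}\,f(Z+S,Y+S)\,g(Z-T,Y+T),$$ where $f(Z+S,Y+S)g(Z-T,Y+T)$ is expanded as a formal power series in $Z,Y,S,T$ and is integrated monomial by monomial, with the Gaussian moments taken along a surface in the complexified $(S,T)$-space on which the weight decays (normalised so that the integral of $1$ is $1$; thus $\langle S^A_iT^B_j\rangle=\tfrac12\epsilon_{ij}\eta^{AB}$). The product $f*g$ is *well defined* (free of infinities) if the coefficient of every monomial in $Z,Y$ receives only finitely many nonzero contributions from the monomials in $S,T$. Put $z_i=V_AZ^A_i$, $y_i=V_AY^A_i$.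 A *regular function* is a finite sum of functions $$P(Z,Y)\int_{M}d\mu(\tau)\,\rho(\tau)\,\exp\big(\phi(\tau)\,z_iy^i\big),$$ where $n\ge 0$, $M\subset\mathbb R^n$ is compact, $\mu$ is a locally finite Borel measure on $\mathbb R^n$ (for instance Lebesgue measure, or a point mass, which corresponds to a delta function density), $\rho:\mathbb R^n\to\mathbb C$ is $\mu$-integrable on $M$, and $P$, $\phi$ are complex polynomials in $(Z,Y)$ and in $\tau$ respectively. A regular function is identified with its power series expansion at $0$. Let $\mathcal R\subset\mathbb C[[Z,Y]]$ be the space of regular functions. **Theorem.** (i) For every $f\in\mathbb C[[Z,Y]]$ and every $g\in\mathcal R$ the star products $f*g$ and $g*f$ are well defined, and are again elements of $\mathbb C[[Z,Y]]$. (ii) $\mathcal R$ contains $1$, is closed under $*$, and is a unital associative $\mathbb C$-algebra under $*$. (iii) $\mathbb C[[Z,Y]]$ is a bimodule over the algebra $(\mathcal R,*)$: the maps $(g,f)\mapsto g*f$ and $(f,g)\mapsto f*g$ are $\mathbb C$-bilinear on $\mathcal R\times\mathbb C[[Z,Y]]$ and $\mathbb C[[Z,Y]]\times\mathcal R$, $1*f=f=f*1$,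 and for all $g,h\in\mathcal R$ and $f\in\mathbb C[[Z,Y]]$ $$(g*h)*f=g*(h*f),\qquad f*(g*h)=(f*g)*h,\qquad (g*f)*h=g*(f*h).$$ -/

import Mathlib

open MvPowerSeries MeasureTheory

noncomputable section

namespace HSStar

/-! ### Oscillator variables

Ambient indices `A = 0, …, d` are the elements of `Fin (d + 1)`, the `sp(2)` indices `i = 1, 2` are
the elements `0, 1` of `Fin 2`. -/

/-- The index set of one family of oscillators: `k = (A, i)` labels `Y^A_i`. -/
abbrev Osc (d : ℕ) : Type := Fin (d + 1) × Fin 2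

/-- The variables `Z^A_i` (left summand) and `Y^A_i` (right summand). -/
abbrev Var (d : ℕ) : Type := Osc d ⊕ Osc d

/-- Formal power series `f(Z, Y)` with complex coefficients. -/
abbrev Series (d : ℕ) : Type := MvPowerSeries (Var d) ℂ

/-- The variables `(Z, Y)` together with the integration variables `(S, T)`. -/
abbrev BigVar (d : ℕ) : Type := Var d ⊕ (Osc d ⊕ Osc d)

/-- The diagonal entries `(+, -, …, -, +)` of the invariant metric `η_{AB} = η^{AB}`. -/
def eta (d : ℕ) (A : Fin (d + 1)) : ℝ := if A = 0 ∨ A = Fin.last d then 1 else -1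

/-- The invariant pairing `S^A_i T^i_A`. Indices are raised and lowered by `a^i = ε^{ij} a_j`,
`ε^{12} = 1` and by `η`, so that it equals `∑_A η_{AA} (S^A_1 T^A_2 - S^A_2 T^A_1)`. -/
def pairing {d : ℕ} (S T : Osc d → ℂ) : ℂ :=
  ∑ A, (eta d A : ℂ) * (S (A, 0) * T (A, 1) - S (A, 1) * T (A, 0))

/-! ### The Gaussian integral over `S, T` -/

/-- The surface in the complexified `(S, T)`-space along which the Gaussian weight decays:
`T^A_2 = η_{AA} conj (S^A_1)` and `T^A_1 = - η_{AA} conj (S^A_2)`. -/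
def contour {d : ℕ} (S : Osc d → ℂ) : Osc d → ℂ := fun k =>
  (if k.2 = 0 then -(eta d k.1 : ℂ) else (eta d k.1 : ℂ)) * star (S (k.1, k.2.rev))

/-- The moment `π^{-2(d+1)} ∫ dS dT exp(-2 S^A_i T^i_A) S^α T^β` of the Gaussian weight.
The integral runs over the surface `T = contour S`, on which it converges absolutely and
on which `dS dT` is `2^{2(d+1)}` times the Lebesgue measure in `S`. -/
def moment {d : ℕ} (α β : Osc d →₀ ℕ) : ℂ :=
  (1 / (Real.pi : ℂ) ^ (2 * (d + 1))) *
    ∫ S : Osc d → ℂ, Complex.exp (-2 * pairing S (contour S)) *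
      ((∏ k, S k ^ α k) * ∏ k, contour S k ^ β k) * 2 ^ (2 * (d + 1))

/-- Gaussian integral over the complex plane. -/
theorem integral_gauss (c : ℂ) (a b : ℕ) :
    ∫ w : ℂ, Complex.exp (-2 * (w * star w)) * (w ^ a * (c * star w) ^ b) * 2 =
      Real.pi * if b = a then (a.factorial : ℂ) * (c / 2) ^ a else 0 := by
  have hw (w : ℂ) : w * star w = ((‖w‖ ^ 2 : ℝ) : ℂ) := by
    simpa [Complex.normSq_eq_norm_sq] using Complex.mul_conj w
  split_ifs with h
  · subst h
    have h1 (w : ℂ) : Complex.exp (-2 * (w * star w)) * (w ^ b * (c * star w) ^ b) * 2 =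
        (2 * c ^ b) * ((‖w‖ ^ ((2 * b : ℕ) : ℝ) * Real.exp (-2 * ‖w‖ ^ (2 : ℝ)) : ℝ) : ℂ) := by
      have h2 : w ^ b * (c * star w) ^ b = c ^ b * (w * star w) ^ b := by ring
      rw [h2, hw, Real.rpow_natCast, Real.rpow_two]
      push_cast
      ring
    simp_rw [h1]
    rw [integral_const_mul, integral_complex_ofReal,
      Complex.integral_rpow_mul_exp_neg_mul_rpow (by norm_num)
        (by have : (0 : ℝ) ≤ ((2 * b : ℕ) : ℝ) := by positivity
            linarith) (by norm_num)]
    have h3 : (((2 * b : ℕ) : ℝ) + 2) / 2 = b + 1 := by push_cast; ring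
    have h4 : -(((2 * b : ℕ) : ℝ) + 2) / 2 = -((b + 1 : ℕ) : ℝ) := by push_cast; ring
    rw [h3, h4, Real.Gamma_nat_eq_factorial, Real.rpow_neg (by norm_num), Real.rpow_natCast]
    push_cast
    rw [div_pow]
    field_simp
    ring
  · rw [mul_zero]
    set I := ∫ w : ℂ, Complex.exp (-2 * (w * star w)) * (w ^ a * (c * star w) ^ b) * 2 with hI
    have key (u : Circle) : I = ((u : ℂ) ^ a * (star (u : ℂ)) ^ b) * I := by
      rw [hI, ← integral_const_mul]
      rw [← ((rotation u).measurePreserving).integral_comp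
        (rotation u).toHomeomorph.measurableEmbedding]
      congr 1
      ext w
      have hu : (u : ℂ) * star (u : ℂ) = 1 := by
        rw [hw, Circle.norm_coe]; simp
      have : (rotation u w) * star (rotation u w) = w * star w := by
        rw [rotation_apply, star_mul']
        linear_combination (w * star w) * hu
      rw [this, rotation_apply, star_mul']
      ring
    have hab : (a : ℂ) - b ≠ 0 := by
      rw [sub_ne_zero]
      exact fun hh => h (by exact_mod_cast hh.symm)
    have hu := key (Circle.exp (Real.pi / ((a : ℝ) - b)))
    have hm : ((Circle.exp (Real.pi / ((a : ℝ) - b)) : ℂ)) ^ a *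
        (star ((Circle.exp (Real.pi / ((a : ℝ) - b)) : ℂ))) ^ b = -1 := by
      rw [Circle.coe_exp, Complex.star_def, ← Complex.exp_conj, ← Complex.exp_nat_mul,
        ← Complex.exp_nat_mul, ← Complex.exp_add, ← Complex.exp_pi_mul_I]
      congr 1
      simp only [map_mul, Complex.conj_ofReal, Complex.conj_I]
      push_cast
      field_simp
      ring
    rw [hm] at hu
    linear_combination hu / 2

/-- Moments of the Gaussian weight in closed form. -/
theorem moment_eq {d : ℕ} (α β : Osc d →₀ ℕ) :
    moment α β = ∏ k : Osc d, if β (k.1, k.2.rev) = α k then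
      ((α k).factorial : ℂ) * ((if k.2 = 0 then (eta d k.1 : ℂ) else -(eta d k.1 : ℂ)) / 2) ^ α k
      else 0 := by
  have heta (A : Fin (d + 1)) : (eta d A : ℂ) * eta d A = 1 := by
    unfold eta; split_ifs <;> simp
  have hexp (S : Osc d → ℂ) : Complex.exp (-2 * pairing S (contour S)) =
      ∏ k, Complex.exp (-2 * (S k * star (S k))) := by
    rw [← Complex.exp_sum, ← Finset.mul_sum, Fintype.sum_prod_type]
    congr 2
    unfold pairing contour
    refine Finset.sum_congr rfl fun A _ => ?_
    simp only [Fin.sum_univ_two]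
    have h0 : (0 : Fin 2).rev = 1 := rfl
    have h1 : (1 : Fin 2).rev = 0 := rfl
    simp only [h0, h1, one_ne_zero, if_true, if_false]
    linear_combination (S (A, 0) * star (S (A, 0)) + S (A, 1) * star (S (A, 1))) * heta A
  let e : Osc d ≃ Osc d := (Equiv.refl _).prodCongr Fin.revPerm
  have hT (S : Osc d → ℂ) : ∏ k, contour S k ^ β k =
      ∏ k : Osc d, ((if k.2 = 0 then (eta d k.1 : ℂ) else -(eta d k.1 : ℂ)) * star (S k)) ^
        β (k.1, k.2.rev) := by
    rw [← e.prod_comp]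
    refine Finset.prod_congr rfl ?_
    rintro ⟨A, i⟩ -
    fin_cases i <;> simp [e, contour]
  have h2 : (2 : ℂ) ^ (2 * (d + 1)) = ∏ _k : Osc d, (2 : ℂ) := by
    simp [mul_comm]
  have hpi : (Real.pi : ℂ) ^ (2 * (d + 1)) = ∏ _k : Osc d, (Real.pi : ℂ) := by
    simp [mul_comm]
  unfold moment
  simp_rw [hexp, hT, h2, ← Finset.prod_mul_distrib]
  rw [MeasureTheory.integral_fintype_prod_volume_eq_prod
    (f := fun (k : Osc d) (w : ℂ) => Complex.exp (-2 * (w * star w)) *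
      (w ^ α k * ((if k.2 = 0 then (eta d k.1 : ℂ) else -(eta d k.1 : ℂ)) * star w) ^
        β (k.1, k.2.rev)) * 2)]
  simp_rw [integral_gauss]
  rw [Finset.prod_mul_distrib, ← hpi, ← mul_assoc, one_div, inv_mul_cancel₀, one_mul]
  exact pow_ne_zero _ (by exact_mod_cast Real.pi_ne_zero)

/-! ### The star product -/

/-- The substitution `(Z, Y) ↦ (Z + S, Y + S)`. -/
def shiftS (d : ℕ) : Var d → MvPowerSeries (BigVar d) ℂ
  | Sum.inl k => X (Sum.inl (Sum.inl k)) + X (Sum.inr (Sum.inl k))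
  | Sum.inr k => X (Sum.inl (Sum.inr k)) + X (Sum.inr (Sum.inl k))

/-- The substitution `(Z, Y) ↦ (Z - T, Y + T)`. -/
def shiftT (d : ℕ) : Var d → MvPowerSeries (BigVar d) ℂ
  | Sum.inl k => X (Sum.inl (Sum.inl k)) - X (Sum.inr (Sum.inr k))
  | Sum.inr k => X (Sum.inl (Sum.inr k)) + X (Sum.inr (Sum.inr k))

theorem hasSubst_shiftS (d : ℕ) : HasSubst (shiftS d) :=
  hasSubst_of_constantCoeff_zero (by rintro (k | k) <;> simp [shiftS])

theorem hasSubst_shiftT (d : ℕ) : HasSubst (shiftT d) :=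
  hasSubst_of_constantCoeff_zero (by rintro (k | k) <;> simp [shiftT])

/-- The factor `f(Z + S, Y + S) g(Z - T, Y + T)` of the integrand, as a power series in
`Z, Y, S, T`. -/
def integrand {d : ℕ} (f g : Series d) : MvPowerSeries (BigVar d) ℂ :=
  subst (shiftS d) f * subst (shiftT d) g

/-- The contribution of the monomial `S^α T^β` of the integrand to the coefficient of the monomial
`m` in `Z, Y` of the star product
`(f * g)(Z, Y) = π^{-2(d+1)} ∫ dS dT exp(-2 S^A_i T^i_A) f(Z + S, Y + S) g(Z - T, Y + T)`. -/
def starTerm {d : ℕ} (f g : Series d) (m : Var d →₀ ℕ)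
    (p : (Osc d →₀ ℕ) × (Osc d →₀ ℕ)) : ℂ :=
  coeff (Finsupp.sumElim m (Finsupp.sumElim p.1 p.2)) (integrand f g) * moment p.1 p.2

/-- The star product of `f` and `g` is well defined (free of infinities): every coefficient of it
receives only finitely many nonzero contributions. -/
def StarDefined {d : ℕ} (f g : Series d) : Prop :=
  ∀ m, {p | starTerm f g m p ≠ 0}.Finite

/-- The star product; meaningful when `StarDefined f g` holds. -/
def starMul {d : ℕ} (f g : Series d) : Series d :=
  fun m => ∑ᶠ p, starTerm f g m p

/-! ### Regular functions -/

/-- `z_i y^i = z_1 y_2 - z_2 y_1` with `z_i = V_A Z^A_i`, `y_i = V_A Y^A_i`,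
`V_A = η_{AB} V^B`. -/
def zy {d : ℕ} (V : Fin (d + 1) → ℝ) : Series d :=
  let z : Fin 2 → Series d := fun i => ∑ A, C ((eta d A * V A : ℝ) : ℂ) * X (Sum.inl (A, i))
  let y : Fin 2 → Series d := fun i => ∑ A, C ((eta d A * V A : ℝ) : ℂ) * X (Sum.inr (A, i))
  z 0 * y 1 - z 1 * y 0

/-- The power series `exp(c z_i y^i)`. -/
def expZY {d : ℕ} (V : Fin (d + 1) → ℝ) (c : ℂ) : Series d :=
  (PowerSeries.exp ℂ).subst (c • zy V)

theorem hasSubst_zy {d : ℕ} (V : Fin (d + 1) → ℝ) (c : ℂ) :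
    PowerSeries.HasSubst (c • zy V) :=
  PowerSeries.HasSubst.of_constantCoeff_zero (by simp [zy, smul_eq_C_mul])

/-- The power series expansion of
`∫_M ρ(τ) exp(φ(τ) z_i y^i) dμ(τ)`, the integral being taken coefficient by coefficient. -/
def integralExp {d n : ℕ} (V : Fin (d + 1) → ℝ) (μ : Measure (Fin n → ℝ)) (M : Set (Fin n → ℝ))
    (ρ : (Fin n → ℝ) → ℂ) (φ : MvPolynomial (Fin n) ℂ) : Series d :=
  fun m => ∫ τ in M, ρ τ * coeff m (expZY V (MvPolynomial.eval (fun i => (τ i : ℂ)) φ)) ∂μ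

/-- Functions of the form `P(Z, Y) ∫_M dμ(τ) ρ(τ) exp(φ(τ) z_i y^i)` with `P`, `φ` polynomials,
`M ⊆ ℝⁿ` compact and `ρ` integrable on `M`. The measure `μ` may be the Lebesgue measure or, to
cover densities with delta functions, any other locally finite measure. -/
def IsElementary {d : ℕ} (V : Fin (d + 1) → ℝ) (f : Series d) : Prop :=
  ∃ (n : ℕ) (μ : Measure (Fin n → ℝ)) (M : Set (Fin n → ℝ)) (ρ : (Fin n → ℝ) → ℂ)
    (φ : MvPolynomial (Fin n) ℂ) (P : MvPolynomial (Var d) ℂ),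
    IsLocallyFiniteMeasure μ ∧ IsCompact M ∧ IntegrableOn ρ M μ ∧
      f = (P : Series d) * integralExp V μ M ρ φ

/-- The space of regular functions: finite sums of elementary ones. -/
def regular {d : ℕ} (V : Fin (d + 1) → ℝ) : Submodule ℂ (Series d) :=
  Submodule.span ℂ {f | IsElementary V f}

end HSStar

end

open MvPowerSeries MeasureTheory

noncomputable section

namespace HSStar

variable {d : ℕ}

/-! Finiteness rests on a grading. Count `S`, `T` with weight `+1` and `Z`, `Y` with weight `-1`.
Under `(Z, Y) ↦ (Z + S, Y + S)` the bilinear `z_i y^i` becomes `z_i y^i + z_i s^i + s_i y^i`, since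
`s_i s^i = 0` by antisymmetry; the same cancellation occurs for `(Z - T, Y + T)`. So a shifted power
series in `z_i y^i` has weight at most `0`, and a polynomial prefactor raises the bound by a
constant only (`banded_powSum`, `banded_of_mem_regular`). At a fixed monomial in `Z, Y` this bounds
the degree in `S` (or in `T`), and Gaussian moments vanish unless both degrees agree. Hence only
finitely many contractions contribute.

The same bound shows that star multiplication by a banded series `g` is local: each coefficient of
`f * g` or `g * f` depends on finitely many coefficients of `f`. Identities between local linear
maps need checking on polynomials only (`IsLocal.eq_of_coe`). On polynomials, Gaussian integration
by parts gives the rules for a variable in the left or right factor (`starMul_X_mul_coe`,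
`starMul_mul_X_coe`). With these, induction on a polynomial first factor proves associativity
(`coe_starMul_starMul`), and locality extends it one argument at a time.

Closure needs `V^A V_A = 1`. Writing `z_i y^i` through `p = y + z` and `q = y - z`, one finds `F(zy)
* (zy · g) = zy · ((F + F')(zy) * g)` (`powSum_starMul_zy_mul`). For `F = exp(φ ·)` the operation `F
↦ F + F'` multiplies by `1 + φ`, so `exp(φ zy) * exp(φ' zy) = exp((φ'(1 + φ) + φ) zy)`. The new
exponent is polynomial in the joint parameters, and Fubini handles the integrals. Polynomial
prefactors are removed one variable at a time, because differentiating such an integral only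
multiplies its density by `φ` and adds a linear prefactor. -/

/-! ### Local linear maps between spaces of power series -/

/-- A linear map between spaces of power series is local if every coefficient of the result depends
on the coefficients of the argument up to some degree only. -/
structure IsLocal {σ τ : Type*} (L : MvPowerSeries σ ℂ → MvPowerSeries τ ℂ) : Prop where
  map_add : ∀ f g, L (f + g) = L f + L g
  map_smul : ∀ (c : ℂ) f, L (c • f) = c • L f
  exists_degree : ∀ m, ∃ K : ℕ, ∀ f, (∀ n : σ →₀ ℕ, n.degree ≤ K → coeff n f = 0) →
    coeff m (L f) = 0

theorem coeff_subst_eq_zero {σ τ : Type*} [Finite σ] {a : σ → MvPowerSeries τ ℂ}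
    (ha : ∀ i, constantCoeff (a i) = 0) (m : τ →₀ ℕ) {f : MvPowerSeries σ ℂ}
    (hf : ∀ n : σ →₀ ℕ, n.degree ≤ m.degree → coeff n f = 0) : coeff m (subst a f) = 0 := by
  refine coeff_of_lt_order (lt_of_lt_of_le ?_ (le_order_subst (hasSubst_of_constantCoeff_zero ha) f))
  have h1 : (1 : ℕ∞) ≤ ⨅ i, (a i).order :=
    le_iInf fun i => one_le_order_iff_constCoeff_eq_zero.2 (ha i)
  have h2 : ((m.degree + 1 : ℕ) : ℕ∞) ≤ f.order :=
    nat_le_order fun n hn => hf n (Nat.lt_succ_iff.1 hn)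
  calc (m.degree : ℕ∞) < ((m.degree + 1 : ℕ) : ℕ∞) := by exact_mod_cast Nat.lt_succ_self _
    _ ≤ f.order := h2
    _ = 1 * f.order := (one_mul _).symm
    _ ≤ _ := mul_le_mul_left h1 _

namespace IsLocal

variable {σ τ υ : Type*} {L L' : MvPowerSeries σ ℂ → MvPowerSeries τ ℂ}

theorem map_zero (h : IsLocal L) : L 0 = 0 := by
  simpa using h.map_smul 0 0

theorem map_neg (h : IsLocal L) (f : MvPowerSeries σ ℂ) : L (-f) = -L f := by
  simpa using h.map_smul (-1) f

theorem map_sub (h : IsLocal L) (f g : MvPowerSeries σ ℂ) : L (f - g) = L f - L g := by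
  rw [sub_eq_add_neg, h.map_add, h.map_neg, ← sub_eq_add_neg]

theorem map_sum (h : IsLocal L) {ι : Type*} (s : Finset ι) (f : ι → MvPowerSeries σ ℂ) :
    L (∑ i ∈ s, f i) = ∑ i ∈ s, L (f i) := by
  classical
  induction s using Finset.induction_on with
  | empty => simpa using h.map_zero
  | insert i s hi ih => rw [Finset.sum_insert hi, Finset.sum_insert hi, h.map_add, ih]

theorem id : IsLocal (fun f : MvPowerSeries σ ℂ => f) where
  map_add _ _ := rfl
  map_smul _ _ := rfl
  exists_degree m := ⟨m.degree, fun _ hf => hf m le_rfl⟩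

theorem comp [Finite τ] {M : MvPowerSeries τ ℂ → MvPowerSeries υ ℂ} (hM : IsLocal M)
    (hL : IsLocal L) : IsLocal fun f => M (L f) where
  map_add f g := by rw [hL.map_add, hM.map_add]
  map_smul c f := by rw [hL.map_smul, hM.map_smul]
  exists_degree m := by
    obtain ⟨K, hK⟩ := hM.exists_degree m
    choose N hN using hL.exists_degree
    -- Only finitely many monomials have degree at most `K`, so the largest of their individual
    -- bounds works for all of them.
    let s := (Finsupp.finite_of_degree_le (σ := τ) K).toFinset
    refine ⟨s.sup N, fun f hf => hK _ fun n hn => hN n f fun k hk => hf k (hk.trans ?_)⟩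
    exact Finset.le_sup (f := N) (by simpa [s] using hn)

theorem add (hL : IsLocal L) (hL' : IsLocal L') : IsLocal fun f => L f + L' f where
  map_add f g := by rw [hL.map_add, hL'.map_add]; abel
  map_smul c f := by rw [hL.map_smul, hL'.map_smul, smul_add]
  exists_degree m := by
    obtain ⟨K, hK⟩ := hL.exists_degree m
    obtain ⟨K', hK'⟩ := hL'.exists_degree m
    refine ⟨max K K', fun f hf => ?_⟩
    rw [_root_.map_add, hK f fun n hn => hf n (hn.trans (le_max_left _ _)),
      hK' f fun n hn => hf n (hn.trans (le_max_right _ _)), add_zero]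

theorem const_smul (hL : IsLocal L) (c : ℂ) : IsLocal fun f => c • L f where
  map_add f g := by rw [hL.map_add, smul_add]
  map_smul a f := by rw [hL.map_smul, smul_comm]
  exists_degree m := by
    obtain ⟨K, hK⟩ := hL.exists_degree m
    exact ⟨K, fun f hf => by rw [coeff_smul, hK f hf, mul_zero]⟩

theorem sub (hL : IsLocal L) (hL' : IsLocal L') : IsLocal fun f => L f - L' f := by
  simpa [sub_eq_add_neg] using hL.add (hL'.const_smul (-1))

theorem mul_left (g : MvPowerSeries σ ℂ) : IsLocal fun f => g * f where
  map_add f f' := mul_add _ _ _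
  map_smul c f := mul_smul_comm _ _ _
  exists_degree m := by
    classical
    refine ⟨m.degree, fun f hf => ?_⟩
    rw [coeff_mul]
    refine Finset.sum_eq_zero fun p hp => ?_
    rw [hf p.2, mul_zero]
    rw [← Finset.HasAntidiagonal.mem_antidiagonal.1 hp, _root_.map_add]
    exact Nat.le_add_left _ _

theorem pderiv (i : σ) : IsLocal fun f => MvPowerSeries.pderiv ℂ i f where
  map_add f g := _root_.map_add _ f g
  map_smul c f := Derivation.map_smul _ c f
  exists_degree m := by
    refine ⟨m.degree + 1, fun f hf => ?_⟩
    rw [coeff_pderiv, hf _ (by rw [_root_.map_add, Finsupp.degree_single]), zero_mul]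

theorem subst [Finite σ] {a : σ → MvPowerSeries τ ℂ} (ha : ∀ i, constantCoeff (a i) = 0) :
    IsLocal fun f : MvPowerSeries σ ℂ => MvPowerSeries.subst a f where
  map_add f g := subst_add (hasSubst_of_constantCoeff_zero ha) f g
  map_smul c f := subst_smul (hasSubst_of_constantCoeff_zero ha) c f
  exists_degree m := ⟨m.degree, fun _ hf => coeff_subst_eq_zero ha m hf⟩

theorem exists_coeff_eq (hL : IsLocal L) (m : τ →₀ ℕ) : ∃ K : ℕ, ∀ f g,
    (∀ n : σ →₀ ℕ, n.degree ≤ K → coeff n f = coeff n g) → coeff m (L f) = coeff m (L g) := by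
  obtain ⟨K, hK⟩ := hL.exists_degree m
  refine ⟨K, fun f g h => ?_⟩
  rw [← sub_eq_zero, ← _root_.map_sub, ← hL.map_sub]
  exact hK _ fun n hn => by rw [_root_.map_sub, h n hn, sub_self]

/-- Truncation above the degree seen by the coefficient changes nothing. The cut is at `K + 1`
because `truncTotal` keeps the degrees strictly below its argument. -/
theorem exists_coeff_eq_coe [Finite σ] (hL : IsLocal L) (m : τ →₀ ℕ) (f : MvPowerSeries σ ℂ) :
    ∃ p : MvPolynomial σ ℂ, coeff m (L f) = coeff m (L p) := by
  obtain ⟨K, hK⟩ := hL.exists_coeff_eq m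
  refine ⟨truncTotal (K + 1) f, hK _ _ fun n hn => ?_⟩
  rw [MvPolynomial.coeff_coe, coeff_truncTotal _ (Nat.lt_succ_iff.2 hn)]

/-- A local linear map that vanishes on polynomials is zero. -/
theorem eq_zero_of_coe [Finite σ] (hL : IsLocal L) (h : ∀ p : MvPolynomial σ ℂ, L p = 0)
    (f : MvPowerSeries σ ℂ) : L f = 0 := by
  ext m
  obtain ⟨p, hp⟩ := hL.exists_coeff_eq_coe m f
  rw [hp, h]

/-- Local linear maps that agree on polynomials are equal. -/
theorem eq_of_coe [Finite σ] (hL : IsLocal L) (hL' : IsLocal L')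
    (h : ∀ p : MvPolynomial σ ℂ, L p = L' p) (f : MvPowerSeries σ ℂ) : L f = L' f :=
  sub_eq_zero.1 ((hL.sub hL').eq_zero_of_coe (fun p => sub_eq_zero.2 (h p)) f)

end IsLocal

/-! ### Gaussian integration by parts -/

/-- The index conjugate to `(A, i)` under the pairing. -/
def bar (k : Osc d) : Osc d := (k.1, k.2.rev)

@[simp] theorem bar_bar (k : Osc d) : bar (bar k) = k := by simp [bar]

theorem bar_injective : Function.Injective (bar : Osc d → Osc d) :=
  Function.LeftInverse.injective bar_bar

/-- The propagator `⟨S_k T_{bar k}⟩`. -/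
def kappa (k : Osc d) : ℂ := (if k.2 = 0 then (eta d k.1 : ℂ) else -(eta d k.1 : ℂ)) / 2

theorem moment_eq_prod (α β : Osc d →₀ ℕ) : moment α β = ∏ k : Osc d,
    if β (bar k) = α k then ((α k).factorial : ℂ) * kappa k ^ α k else 0 :=
  moment_eq α β

/-- Wick's rule: the extra `S_k` contracts with one of the `β (bar k)` factors `T_{bar k}`. When
there are none, the truncated subtraction is harmless because the prefactor vanishes. -/
theorem moment_add_single_left (α β : Osc d →₀ ℕ) (k : Osc d) :
    moment (α + Finsupp.single k 1) β =
      kappa k * (β (bar k) * moment α (β - Finsupp.single (bar k) 1)) := by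
  classical
  rw [moment_eq_prod, moment_eq_prod, ← Finset.mul_prod_erase _ _ (Finset.mem_univ k),
    ← Finset.mul_prod_erase _ _ (Finset.mem_univ k), ← mul_assoc, ← mul_assoc]
  congr 1
  · simp only [Finsupp.add_apply, Finsupp.single_eq_same, Finsupp.tsub_apply]
    rcases Nat.eq_zero_or_pos (β (bar k)) with h | h
    · simp [h]
    · by_cases h' : β (bar k) = α k + 1
      · rw [if_pos h', if_pos (by omega), h', Nat.factorial_succ]
        push_cast
        ring
      · rw [if_neg h', if_neg (by omega), mul_zero]
  · refine Finset.prod_congr rfl fun j hj => ?_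
    have hjk := Finset.ne_of_mem_erase hj
    rw [Finsupp.add_apply, Finsupp.tsub_apply, Finsupp.single_eq_of_ne hjk,
      Finsupp.single_eq_of_ne (bar_injective.ne hjk)]
    simp

theorem moment_add_single_right (α β : Osc d →₀ ℕ) (k : Osc d) :
    moment α (β + Finsupp.single k 1) =
      kappa (bar k) * (α (bar k) * moment (α - Finsupp.single (bar k) 1) β) := by
  classical
  rw [moment_eq_prod, moment_eq_prod, ← Finset.mul_prod_erase _ _ (Finset.mem_univ (bar k)),
    ← Finset.mul_prod_erase _ _ (Finset.mem_univ (bar k)), ← mul_assoc, ← mul_assoc]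
  congr 1
  · simp only [bar_bar, Finsupp.add_apply, Finsupp.single_eq_same, Finsupp.tsub_apply]
    rcases Nat.eq_zero_or_pos (α (bar k)) with h | h
    · simp [h]
    · by_cases h' : β k + 1 = α (bar k)
      · rw [if_pos h', if_pos (by omega), ← h', Nat.factorial_succ]
        simp only [Nat.add_sub_cancel]
        push_cast
        ring
      · rw [if_neg h', if_neg (by omega), mul_zero]
  · refine Finset.prod_congr rfl fun j hj => ?_
    have hjk := Finset.ne_of_mem_erase hj
    have hjk' : bar j ≠ k := fun h => hjk (by rw [← h, bar_bar])
    rw [Finsupp.add_apply, Finsupp.tsub_apply, Finsupp.single_eq_of_ne hjk,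
      Finsupp.single_eq_of_ne hjk']
    simp

/-- The Gaussian integral over `(S, T)`, monomial by monomial. -/
def gauss (F : MvPowerSeries (BigVar d) ℂ) : Series d := fun m =>
  ∑ᶠ p : (Osc d →₀ ℕ) × (Osc d →₀ ℕ),
    coeff (Finsupp.sumElim m (Finsupp.sumElim p.1 p.2)) F * moment p.1 p.2

theorem starMul_eq_gauss (f g : Series d) : starMul f g = gauss (integrand f g) := rfl

theorem coeff_gauss (F : MvPowerSeries (BigVar d) ℂ) (m : Var d →₀ ℕ) : coeff m (gauss F) =
    ∑ᶠ p : (Osc d →₀ ℕ) × (Osc d →₀ ℕ),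
      coeff (Finsupp.sumElim m (Finsupp.sumElim p.1 p.2)) F * moment p.1 p.2 := rfl

theorem sumElim_eq_iff {σ τ : Type*} {a a' : σ →₀ ℕ} {b b' : τ →₀ ℕ} :
    Finsupp.sumElim a b = Finsupp.sumElim a' b' ↔ a = a' ∧ b = b' := by
  refine ⟨fun h => ⟨?_, ?_⟩, fun h => by rw [h.1, h.2]⟩
  · ext i; simpa using DFunLike.congr_fun h (Sum.inl i)
  · ext i; simpa using DFunLike.congr_fun h (Sum.inr i)

theorem finite_support_gauss_coe (F : MvPolynomial (BigVar d) ℂ) (m : Var d →₀ ℕ) :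
    (Function.support fun p : (Osc d →₀ ℕ) × (Osc d →₀ ℕ) =>
      coeff (Finsupp.sumElim m (Finsupp.sumElim p.1 p.2))
        (F : MvPowerSeries (BigVar d) ℂ) * moment p.1 p.2).Finite := by
  have hinj : Function.Injective fun p : (Osc d →₀ ℕ) × (Osc d →₀ ℕ) =>
      (Finsupp.sumElim m (Finsupp.sumElim p.1 p.2) : BigVar d →₀ ℕ) := by
    rintro ⟨a, b⟩ ⟨a', b'⟩ h
    have := (sumElim_eq_iff.1 (sumElim_eq_iff.1 h).2)
    exact Prod.ext this.1 this.2
  refine (F.support.finite_toSet.preimage hinj.injOn).subset fun p hp => ?_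
  simp only [Function.mem_support, MvPolynomial.coeff_coe] at hp
  simpa [MvPolynomial.mem_support_iff] using left_ne_zero_of_mul hp

/-- The Gaussian integral of polynomials as a linear map. -/
def gaussLin (d : ℕ) : MvPolynomial (BigVar d) ℂ →ₗ[ℂ] Series d where
  toFun F := gauss F
  map_add' F G := by
    ext m
    rw [map_add, coeff_gauss, coeff_gauss, coeff_gauss, ← finsum_add_distrib
      (finite_support_gauss_coe F m) (finite_support_gauss_coe G m)]
    simp [add_mul]
  map_smul' c F := by
    ext m
    rw [RingHom.id_apply, coeff_smul, coeff_gauss, coeff_gauss, mul_finsum]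
    simp [mul_assoc]

theorem gaussLin_apply (F : MvPolynomial (BigVar d) ℂ) : gaussLin d F = gauss F := rfl

theorem gaussLin_monomial (m : Var d →₀ ℕ) (α β : Osc d →₀ ℕ) (c : ℂ) :
    gaussLin d (MvPolynomial.monomial (Finsupp.sumElim m (Finsupp.sumElim α β)) c) =
      monomial m (c * moment α β) := by
  classical
  ext n
  rw [gaussLin_apply, coeff_gauss, finsum_eq_single _ (α, β)]
  · simp only [MvPolynomial.coeff_coe, MvPolynomial.coeff_monomial, sumElim_eq_iff, coeff_monomial]
    by_cases h : m = n <;> simp [h, eq_comm]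
  · rintro ⟨a, b⟩ hab
    rw [MvPolynomial.coeff_coe, MvPolynomial.coeff_monomial, if_neg, zero_mul]
    rintro h
    have := (sumElim_eq_iff.1 (sumElim_eq_iff.1 h).2)
    exact hab (Prod.ext this.1.symm this.2.symm)

theorem exists_sumElim {σ τ : Type*} (s : σ ⊕ τ →₀ ℕ) : ∃ a b, s = Finsupp.sumElim a b :=
  ⟨_, _, (Finsupp.comapDomain_sumElim_comapDomain s).symm⟩

theorem linearMap_ext_monomial {M : Type*} [AddCommMonoid M] [Module ℂ M]
    {L L' : MvPolynomial (BigVar d) ℂ →ₗ[ℂ] M}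
    (h : ∀ m α β, L (MvPolynomial.monomial (Finsupp.sumElim m (Finsupp.sumElim α β)) 1) =
      L' (MvPolynomial.monomial (Finsupp.sumElim m (Finsupp.sumElim α β)) 1)) : L = L' := by
  refine MvPolynomial.linearMap_ext fun s => LinearMap.ext_ring ?_
  obtain ⟨m, t, rfl⟩ := exists_sumElim s
  obtain ⟨α, β, rfl⟩ := exists_sumElim t
  exact h m α β

theorem sumElim_add_single_inl {σ τ : Type*} (a : σ →₀ ℕ) (b : τ →₀ ℕ) (i : σ) (n : ℕ) :
    Finsupp.sumElim a b + Finsupp.single (Sum.inl i) n =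
      Finsupp.sumElim (a + Finsupp.single i n) b := by
  rw [← Finsupp.sumElim_single_zero, ← Finsupp.sumElim_add, add_zero]

theorem sumElim_add_single_inr {σ τ : Type*} (a : σ →₀ ℕ) (b : τ →₀ ℕ) (i : τ) (n : ℕ) :
    Finsupp.sumElim a b + Finsupp.single (Sum.inr i) n =
      Finsupp.sumElim a (b + Finsupp.single i n) := by
  rw [← Finsupp.sumElim_zero_single, ← Finsupp.sumElim_add, add_zero]

theorem sumElim_sub_single_inl {σ τ : Type*} (a : σ →₀ ℕ) (b : τ →₀ ℕ) (i : σ) (n : ℕ) :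
    Finsupp.sumElim a b - Finsupp.single (Sum.inl i) n =
      Finsupp.sumElim (a - Finsupp.single i n) b := by
  classical
  ext (j | j) <;> simp [Finsupp.single_apply]

theorem sumElim_sub_single_inr {σ τ : Type*} (a : σ →₀ ℕ) (b : τ →₀ ℕ) (i : τ) (n : ℕ) :
    Finsupp.sumElim a b - Finsupp.single (Sum.inr i) n =
      Finsupp.sumElim a (b - Finsupp.single i n) := by
  classical
  ext (j | j) <;> simp [Finsupp.single_apply]

theorem X_mul_monomial {σ : Type*} (i : σ) (s : σ →₀ ℕ) (c : ℂ) :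
    MvPolynomial.X i * MvPolynomial.monomial s c =
      MvPolynomial.monomial (s + Finsupp.single i 1) c := by
  rw [MvPolynomial.X, MvPolynomial.monomial_mul, one_mul, add_comm]

theorem gaussLin_X_mul (v : Var d) (F : MvPolynomial (BigVar d) ℂ) :
    gaussLin d (MvPolynomial.X (Sum.inl v) * F) = X v * gaussLin d F := by
  have : gaussLin d ∘ₗ LinearMap.mulLeft ℂ (MvPolynomial.X (Sum.inl v)) =
      LinearMap.mulLeft ℂ (X v) ∘ₗ gaussLin d := by
    refine linearMap_ext_monomial fun m α β => ?_
    simp only [LinearMap.comp_apply, LinearMap.mulLeft_apply]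
    rw [X_mul_monomial, sumElim_add_single_inl, gaussLin_monomial, gaussLin_monomial,
      X_def, monomial_mul_monomial, add_comm, one_mul, one_mul]
  exact LinearMap.congr_fun this F

theorem gaussLin_pderiv (v : Var d) (F : MvPolynomial (BigVar d) ℂ) :
    gaussLin d (MvPolynomial.pderiv (Sum.inl v) F) = pderiv ℂ v (gaussLin d F) := by
  have : gaussLin d ∘ₗ (MvPolynomial.pderiv (Sum.inl v)).toLinearMap =
      (pderiv ℂ v).toLinearMap ∘ₗ gaussLin d := by
    refine linearMap_ext_monomial fun m α β => ?_
    simp only [LinearMap.comp_apply, Derivation.coeFn_coe]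
    rw [MvPolynomial.pderiv_monomial, sumElim_sub_single_inl, gaussLin_monomial,
      gaussLin_monomial, ← MvPolynomial.coe_monomial m, pderiv_coe, MvPolynomial.pderiv_monomial,
      MvPolynomial.coe_monomial, Finsupp.sumElim_inl]
    congr 1
    ring
  exact LinearMap.congr_fun this F

/-- Integration by parts: against the weight `exp(-2 S T)`, multiplication by `S` is a multiple of
the derivative in the conjugate `T`. -/
theorem gaussLin_S_mul (k : Osc d) (F : MvPolynomial (BigVar d) ℂ) :
    gaussLin d (MvPolynomial.X (Sum.inr (Sum.inl k)) * F) =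
      kappa k • gaussLin d (MvPolynomial.pderiv (Sum.inr (Sum.inr (bar k))) F) := by
  have : gaussLin d ∘ₗ LinearMap.mulLeft ℂ (MvPolynomial.X (Sum.inr (Sum.inl k))) =
      kappa k • gaussLin d ∘ₗ
        (MvPolynomial.pderiv (Sum.inr (Sum.inr (bar k)))).toLinearMap := by
    refine linearMap_ext_monomial fun m α β => ?_
    simp only [LinearMap.comp_apply, LinearMap.mulLeft_apply, LinearMap.smul_apply,
      Derivation.coeFn_coe]
    rw [X_mul_monomial, sumElim_add_single_inr, sumElim_add_single_inl, gaussLin_monomial,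
      MvPolynomial.pderiv_monomial, sumElim_sub_single_inr, sumElim_sub_single_inr,
      gaussLin_monomial, moment_add_single_left, Finsupp.sumElim_inr, Finsupp.sumElim_inr,
      ← map_smul, smul_eq_mul]
    simp
  exact LinearMap.congr_fun this F

theorem gaussLin_T_mul (k : Osc d) (F : MvPolynomial (BigVar d) ℂ) :
    gaussLin d (MvPolynomial.X (Sum.inr (Sum.inr k)) * F) =
      kappa (bar k) • gaussLin d (MvPolynomial.pderiv (Sum.inr (Sum.inl (bar k))) F) := by
  have : gaussLin d ∘ₗ LinearMap.mulLeft ℂ (MvPolynomial.X (Sum.inr (Sum.inr k))) =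
      kappa (bar k) • gaussLin d ∘ₗ
        (MvPolynomial.pderiv (Sum.inr (Sum.inl (bar k)))).toLinearMap := by
    refine linearMap_ext_monomial fun m α β => ?_
    simp only [LinearMap.comp_apply, LinearMap.mulLeft_apply, LinearMap.smul_apply,
      Derivation.coeFn_coe]
    rw [X_mul_monomial, sumElim_add_single_inr, sumElim_add_single_inr, gaussLin_monomial,
      MvPolynomial.pderiv_monomial, sumElim_sub_single_inr, sumElim_sub_single_inl,
      gaussLin_monomial, moment_add_single_right, Finsupp.sumElim_inr, Finsupp.sumElim_inl,
      ← map_smul, smul_eq_mul]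
    simp
  exact LinearMap.congr_fun this F

/-! ### The star product of polynomials -/

theorem coe_sub' {σ : Type*} (f g : MvPolynomial σ ℂ) :
    ((f - g : MvPolynomial σ ℂ) : MvPowerSeries σ ℂ) = f - g := by
  ext; simp

/-- The substitution `(Z, Y) ↦ (Z + S, Y + S)` of polynomials. -/
def polyShiftS (d : ℕ) : MvPolynomial (Var d) ℂ →ₐ[ℂ] MvPolynomial (BigVar d) ℂ :=
  MvPolynomial.aeval (Sum.elim
    (fun k => MvPolynomial.X (Sum.inl (Sum.inl k)) + MvPolynomial.X (Sum.inr (Sum.inl k)))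
    (fun k => MvPolynomial.X (Sum.inl (Sum.inr k)) + MvPolynomial.X (Sum.inr (Sum.inl k))))

/-- The substitution `(Z, Y) ↦ (Z - T, Y + T)` of polynomials. -/
def polyShiftT (d : ℕ) : MvPolynomial (Var d) ℂ →ₐ[ℂ] MvPolynomial (BigVar d) ℂ :=
  MvPolynomial.aeval (Sum.elim
    (fun k => MvPolynomial.X (Sum.inl (Sum.inl k)) - MvPolynomial.X (Sum.inr (Sum.inr k)))
    (fun k => MvPolynomial.X (Sum.inl (Sum.inr k)) + MvPolynomial.X (Sum.inr (Sum.inr k))))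

theorem subst_shiftS_coe (f : MvPolynomial (Var d) ℂ) :
    subst (shiftS d) (f : Series d) = (polyShiftS d f : MvPowerSeries (BigVar d) ℂ) := by
  rw [subst_coe]
  have : MvPolynomial.aeval (R := ℂ) (shiftS d) =
      (MvPolynomial.coeToMvPowerSeries.algHom ℂ).comp (polyShiftS d) := by
    refine MvPolynomial.algHom_ext fun v => ?_
    rcases v with k | k <;> simp [shiftS, polyShiftS]
  rw [this]
  simp

theorem subst_shiftT_coe (f : MvPolynomial (Var d) ℂ) :
    subst (shiftT d) (f : Series d) = (polyShiftT d f : MvPowerSeries (BigVar d) ℂ) := by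
  rw [subst_coe]
  have : MvPolynomial.aeval (R := ℂ) (shiftT d) =
      (MvPolynomial.coeToMvPowerSeries.algHom ℂ).comp (polyShiftT d) := by
    refine MvPolynomial.algHom_ext fun v => ?_
    rcases v with k | k <;> simp [shiftT, polyShiftT, coe_sub']
  rw [this]
  simp

theorem starMul_coe_coe (f g : MvPolynomial (Var d) ℂ) :
    starMul (f : Series d) (g : Series d) = gaussLin d (polyShiftS d f * polyShiftT d g) := by
  rw [starMul_eq_gauss, integrand, subst_shiftS_coe, subst_shiftT_coe, ← MvPolynomial.coe_mul,
    gaussLin_apply]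

/-- The derivation `∂/∂Y_k + ∂/∂Z_k`. -/
def derivP (k : Osc d) : Derivation ℂ (Series d) (Series d) :=
  pderiv ℂ (Sum.inr k) + pderiv ℂ (Sum.inl k)

/-- The derivation `∂/∂Y_k - ∂/∂Z_k`. -/
def derivM (k : Osc d) : Derivation ℂ (Series d) (Series d) :=
  pderiv ℂ (Sum.inr k) - pderiv ℂ (Sum.inl k)

theorem isLocal_derivP (k : Osc d) : IsLocal (derivP k) :=
  (IsLocal.pderiv (Sum.inr k)).add (IsLocal.pderiv (Sum.inl k))

theorem isLocal_derivM (k : Osc d) : IsLocal (derivM k) :=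
  (IsLocal.pderiv (Sum.inr k)).sub (IsLocal.pderiv (Sum.inl k))

/-- The derivation `∂/∂Y_k + ∂/∂Z_k` on polynomials. -/
def polyDerivP (k : Osc d) : Derivation ℂ (MvPolynomial (Var d) ℂ) (MvPolynomial (Var d) ℂ) :=
  MvPolynomial.pderiv (Sum.inr k) + MvPolynomial.pderiv (Sum.inl k)

/-- The derivation `∂/∂Y_k - ∂/∂Z_k` on polynomials. -/
def polyDerivM (k : Osc d) : Derivation ℂ (MvPolynomial (Var d) ℂ) (MvPolynomial (Var d) ℂ) :=
  MvPolynomial.pderiv (Sum.inr k) - MvPolynomial.pderiv (Sum.inl k)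

theorem derivP_coe (k : Osc d) (f : MvPolynomial (Var d) ℂ) :
    derivP k (f : Series d) = (polyDerivP k f : MvPolynomial (Var d) ℂ) := by
  simp [derivP, polyDerivP, pderiv_coe]

theorem derivM_coe (k : Osc d) (f : MvPolynomial (Var d) ℂ) :
    derivM k (f : Series d) = (polyDerivM k f : MvPolynomial (Var d) ℂ) := by
  simp [derivM, polyDerivM, pderiv_coe, coe_sub']

/-- Chain rule for derivations and substitutions. -/
theorem derivation_aeval {σ B : Type*} [CommRing B] [Algebra ℂ B] (D : Derivation ℂ B B)
    (E : Derivation ℂ (MvPolynomial σ ℂ) (MvPolynomial σ ℂ)) (a : σ → B)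
    (h : ∀ v, D (a v) = MvPolynomial.aeval a (E (MvPolynomial.X v))) (f : MvPolynomial σ ℂ) :
    D (MvPolynomial.aeval a f) = MvPolynomial.aeval a (E f) := by
  induction f using MvPolynomial.induction_on with
  | C c => simp [MvPolynomial.derivation_C]
  | add p q hp hq => simp [hp, hq]
  | mul_X p v hp => simp [Derivation.leibniz, hp, h]

theorem pderiv_polyShiftS (v : Var d) (f : MvPolynomial (Var d) ℂ) :
    MvPolynomial.pderiv (Sum.inl v) (polyShiftS d f) = polyShiftS d (MvPolynomial.pderiv v f) := by
  classical
  refine derivation_aeval _ _ _ ?_ f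
  rintro (k | k) <;> simp [MvPolynomial.pderiv_X, Pi.single_apply, apply_ite]

theorem pderiv_polyShiftT (v : Var d) (f : MvPolynomial (Var d) ℂ) :
    MvPolynomial.pderiv (Sum.inl v) (polyShiftT d f) = polyShiftT d (MvPolynomial.pderiv v f) := by
  classical
  refine derivation_aeval _ _ _ ?_ f
  rintro (k | k) <;> simp [MvPolynomial.pderiv_X, Pi.single_apply, apply_ite]

/-- `S` enters only through `Z + S` and `Y + S`, hence the sum of the two derivatives. In the other
shift `T` enters through `Z - T`, hence the difference. -/
theorem pderiv_S_polyShiftS (k : Osc d) (f : MvPolynomial (Var d) ℂ) :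
    MvPolynomial.pderiv (Sum.inr (Sum.inl k)) (polyShiftS d f) =
      polyShiftS d (polyDerivP k f) := by
  classical
  refine derivation_aeval _ _ _ ?_ f
  rintro (j | j) <;> simp [polyDerivP, MvPolynomial.pderiv_X, Pi.single_apply, apply_ite]

theorem pderiv_T_polyShiftT (k : Osc d) (f : MvPolynomial (Var d) ℂ) :
    MvPolynomial.pderiv (Sum.inr (Sum.inr k)) (polyShiftT d f) =
      polyShiftT d (polyDerivM k f) := by
  classical
  refine derivation_aeval _ _ _ ?_ f
  rintro (j | j) <;> simp [polyDerivM, MvPolynomial.pderiv_X, Pi.single_apply, apply_ite]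

theorem pderiv_T_polyShiftS (k : Osc d) (f : MvPolynomial (Var d) ℂ) :
    MvPolynomial.pderiv (Sum.inr (Sum.inr k)) (polyShiftS d f) = 0 := by
  refine (derivation_aeval _ 0 _ ?_ f).trans (by simp)
  rintro (j | j) <;> simp [MvPolynomial.pderiv_X]

theorem pderiv_S_polyShiftT (k : Osc d) (f : MvPolynomial (Var d) ℂ) :
    MvPolynomial.pderiv (Sum.inr (Sum.inl k)) (polyShiftT d f) = 0 := by
  refine (derivation_aeval _ 0 _ ?_ f).trans (by simp)
  rintro (j | j) <;> simp [MvPolynomial.pderiv_X]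

/-- The oscillator index of a variable. -/
def osc : Var d → Osc d := Sum.elim id id

/-- The sign `-1` for `Z`, `1` for `Y`. -/
def sgn : Var d → ℂ := Sum.elim (fun _ => -1) (fun _ => 1)

/-- The shifted variable is `X v + S`. Integration by parts turns `S` into a `T`-derivative, which
acts on the right factor alone. -/
theorem starMul_X_mul_coe (v : Var d) (f g : MvPolynomial (Var d) ℂ) :
    starMul (X v * (f : Series d)) g = X v * starMul (f : Series d) g +
      kappa (osc v) • starMul (f : Series d) (derivM (bar (osc v)) (g : Series d)) := by
  have hX : polyShiftS d (MvPolynomial.X v) =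
      MvPolynomial.X (Sum.inl v) + MvPolynomial.X (Sum.inr (Sum.inl (osc v))) := by
    rcases v with k | k <;> simp [polyShiftS, osc]
  rw [← MvPolynomial.coe_X, ← MvPolynomial.coe_mul, derivM_coe, starMul_coe_coe, starMul_coe_coe,
    starMul_coe_coe, map_mul (polyShiftS d), hX, add_mul, add_mul, map_add, mul_assoc, mul_assoc,
    gaussLin_X_mul, gaussLin_S_mul, Derivation.leibniz, pderiv_T_polyShiftS,
    pderiv_T_polyShiftT, smul_zero, add_zero, smul_eq_mul, MvPolynomial.coe_X]

theorem starMul_mul_X_coe (v : Var d) (f g : MvPolynomial (Var d) ℂ) :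
    starMul (f : Series d) (X v * (g : Series d)) = X v * starMul (f : Series d) g +
      (sgn v * kappa (bar (osc v))) •
        starMul (derivP (bar (osc v)) (f : Series d)) (g : Series d) := by
  have hX : polyShiftT d (MvPolynomial.X v) =
      MvPolynomial.X (Sum.inl v) + sgn v • MvPolynomial.X (Sum.inr (Sum.inr (osc v))) := by
    rcases v with k | k <;> simp [polyShiftT, osc, sgn, sub_eq_add_neg]
  rw [← MvPolynomial.coe_X, ← MvPolynomial.coe_mul, derivP_coe, starMul_coe_coe, starMul_coe_coe,
    starMul_coe_coe, map_mul (polyShiftT d), hX, mul_left_comm, add_mul, smul_mul_assoc, map_add, map_smul,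
    gaussLin_X_mul, gaussLin_T_mul, Derivation.leibniz, pderiv_S_polyShiftS,
    pderiv_S_polyShiftT, smul_zero, zero_add, smul_eq_mul, MvPolynomial.coe_X, smul_smul,
    mul_comm (polyShiftT d g)]

theorem pderiv_starMul_coe (v : Var d) (f g : MvPolynomial (Var d) ℂ) :
    pderiv ℂ v (starMul (f : Series d) (g : Series d)) =
      starMul (pderiv ℂ v (f : Series d)) (g : Series d) +
        starMul (f : Series d) (pderiv ℂ v (g : Series d)) := by
  rw [pderiv_coe, pderiv_coe, starMul_coe_coe, starMul_coe_coe, starMul_coe_coe,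
    ← gaussLin_pderiv, Derivation.leibniz, pderiv_polyShiftS, pderiv_polyShiftT, map_add,
    smul_eq_mul, smul_eq_mul, add_comm, mul_comm (polyShiftT d g)]

/-- This is `f * 1 = f`: the correction term in `starMul_X_mul_coe` differentiates `1`, and the base
case is the normalisation of the Gaussian. -/
theorem gaussLin_polyShiftS (f : MvPolynomial (Var d) ℂ) : gaussLin d (polyShiftS d f) = f := by
  induction f using MvPolynomial.induction_on with
  | C c =>
    have := gaussLin_monomial (0 : Var d →₀ ℕ) 0 0 c
    have hm : moment (0 : Osc d →₀ ℕ) 0 = 1 := by simp [moment_eq_prod]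
    rw [Finsupp.sumElim_zero_zero, Finsupp.sumElim_zero_zero, hm, mul_one] at this
    rw [MvPolynomial.algHom_C, MvPolynomial.algebraMap_eq, MvPolynomial.coe_C]
    exact this
  | add p q hp hq => simp [hp, hq]
  | mul_X p v hp =>
    have := starMul_X_mul_coe v p 1
    rw [← MvPolynomial.coe_X, ← MvPolynomial.coe_mul, starMul_coe_coe, starMul_coe_coe,
      derivM_coe, starMul_coe_coe] at this
    simpa [hp, mul_comm] using this

theorem gaussLin_polyShiftT (f : MvPolynomial (Var d) ℂ) : gaussLin d (polyShiftT d f) = f := by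
  induction f using MvPolynomial.induction_on with
  | C c =>
    have := gaussLin_polyShiftS (MvPolynomial.C c : MvPolynomial (Var d) ℂ)
    rwa [MvPolynomial.algHom_C] at this ⊢
  | add p q hp hq => simp [hp, hq]
  | mul_X p v hp =>
    have := starMul_mul_X_coe v 1 p
    rw [← MvPolynomial.coe_X, ← MvPolynomial.coe_mul, starMul_coe_coe, starMul_coe_coe,
      derivP_coe, starMul_coe_coe] at this
    simpa [hp, mul_comm] using this

theorem starMul_coe_one (f : MvPolynomial (Var d) ℂ) : starMul (f : Series d) 1 = f := by
  rw [← MvPolynomial.coe_one, starMul_coe_coe, map_one, mul_one, gaussLin_polyShiftS]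

theorem starMul_one_coe (f : MvPolynomial (Var d) ℂ) : starMul 1 (f : Series d) = f := by
  rw [← MvPolynomial.coe_one, starMul_coe_coe, map_one, one_mul, gaussLin_polyShiftT]

/-! ### Series with bounded excess -/

/-- The weight counting `S`, `T` positively and `Z`, `Y` negatively. -/
def excess (d : ℕ) : (BigVar d →₀ ℕ) →+ ℤ := Finsupp.weight (Sum.elim (fun _ => -1) (fun _ => 1))

/-- All monomials of `F` have excess at most `N`. -/
def Bounded (N : ℤ) (F : MvPowerSeries (BigVar d) ℂ) : Prop :=
  ∀ n, coeff n F ≠ 0 → excess d n ≤ N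

namespace Bounded

variable {N M : ℤ} {F G : MvPowerSeries (BigVar d) ℂ}

theorem mono (h : Bounded N F) (hNM : N ≤ M) : Bounded M F := fun n hn => (h n hn).trans hNM

theorem add (hF : Bounded N F) (hG : Bounded N G) : Bounded N (F + G) := fun n hn => by
  by_cases h : coeff n F = 0
  · exact hG n fun h' => hn (by rw [map_add, h, h', add_zero])
  · exact hF n h

theorem neg (hF : Bounded N F) : Bounded N (-F) := fun n hn => hF n (by simpa using hn)

theorem sub (hF : Bounded N F) (hG : Bounded N G) : Bounded N (F - G) := by
  rw [sub_eq_add_neg]; exact hF.add hG.neg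

theorem smul (c : ℂ) (hF : Bounded N F) : Bounded N (c • F) :=
  fun n hn => hF n fun h => hn (by rw [coeff_smul, h, mul_zero])

theorem zero : Bounded N (0 : MvPowerSeries (BigVar d) ℂ) := fun _ hn => absurd (map_zero _) hn

theorem sum {ι : Type*} (s : Finset ι) {f : ι → MvPowerSeries (BigVar d) ℂ}
    (h : ∀ i ∈ s, Bounded N (f i)) : Bounded N (∑ i ∈ s, f i) :=
  Finset.sum_induction f (Bounded N) (fun _ _ => add) zero h

theorem mul (hF : Bounded N F) (hG : Bounded M G) : Bounded (N + M) (F * G) := fun n hn => by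
  classical
  rw [coeff_mul] at hn
  obtain ⟨p, hp, hne⟩ := Finset.exists_ne_zero_of_sum_ne_zero hn
  rw [← Finset.HasAntidiagonal.mem_antidiagonal.1 hp, map_add]
  exact add_le_add (hF _ (left_ne_zero_of_mul hne)) (hG _ (right_ne_zero_of_mul hne))

theorem one : Bounded 0 (1 : MvPowerSeries (BigVar d) ℂ) := fun n hn => by
  classical
  rw [coeff_one] at hn
  have : n = 0 := by by_contra h; simp [h] at hn
  simp [this]

theorem pow (hF : Bounded 0 F) (k : ℕ) : Bounded 0 (F ^ k) := by
  induction k with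
  | zero => simpa using one
  | succ k ih => simpa [pow_succ] using ih.mul hF

theorem C_mul_X (c : ℂ) (v : BigVar d) :
    Bounded (Sum.elim (fun _ => -1) (fun _ => 1) v : ℤ)
      (C c * X v : MvPowerSeries (BigVar d) ℂ) := fun n hn => by
  classical
  rw [coeff_C_mul, coeff_X] at hn
  have : n = Finsupp.single v 1 := by by_contra h; simp [h] at hn
  rw [this, excess, Finsupp.weight_single]
  simp

theorem exists_coe (p : MvPolynomial (BigVar d) ℂ) :
    ∃ N, Bounded N (p : MvPowerSeries (BigVar d) ℂ) := by
  obtain ⟨N, hN⟩ := (p.support.image (excess d)).bddAbove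
  exact ⟨N, fun n hn => hN (by
    rw [MvPolynomial.coeff_coe] at hn
    simpa using ⟨n, hn, rfl⟩)⟩

end Bounded

/-- The shifted series `g(Z + S, Y + S)` and `g(Z - T, Y + T)` have bounded excess. -/
def Banded (g : Series d) : Prop :=
  ∃ N, Bounded N (subst (shiftS d) g) ∧ Bounded N (subst (shiftT d) g)

namespace Banded

variable {f g : Series d}

theorem add (hf : Banded f) (hg : Banded g) : Banded (f + g) := by
  obtain ⟨N, h1, h2⟩ := hf
  obtain ⟨M, h3, h4⟩ := hg
  refine ⟨max N M, ?_, ?_⟩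
  · rw [subst_add (hasSubst_shiftS d)]
    exact (h1.mono (le_max_left _ _)).add (h3.mono (le_max_right _ _))
  · rw [subst_add (hasSubst_shiftT d)]
    exact (h2.mono (le_max_left _ _)).add (h4.mono (le_max_right _ _))

theorem smul (c : ℂ) (hf : Banded f) : Banded (c • f) := by
  obtain ⟨N, h1, h2⟩ := hf
  refine ⟨N, ?_, ?_⟩
  · rw [subst_smul (hasSubst_shiftS d)]; exact h1.smul c
  · rw [subst_smul (hasSubst_shiftT d)]; exact h2.smul c

theorem mul (hf : Banded f) (hg : Banded g) : Banded (f * g) := by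
  obtain ⟨N, h1, h2⟩ := hf
  obtain ⟨M, h3, h4⟩ := hg
  refine ⟨N + M, ?_, ?_⟩
  · rw [subst_mul (hasSubst_shiftS d)]; exact h1.mul h3
  · rw [subst_mul (hasSubst_shiftT d)]; exact h2.mul h4

theorem coe (p : MvPolynomial (Var d) ℂ) : Banded (p : Series d) := by
  obtain ⟨N, hN⟩ := Bounded.exists_coe (polyShiftS d p)
  obtain ⟨M, hM⟩ := Bounded.exists_coe (polyShiftT d p)
  refine ⟨max N M, ?_, ?_⟩
  · rw [subst_shiftS_coe]; exact hN.mono (le_max_left _ _)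
  · rw [subst_shiftT_coe]; exact hM.mono (le_max_right _ _)

theorem zero : Banded (0 : Series d) := by
  simpa using coe (0 : MvPolynomial (Var d) ℂ)

end Banded

/-! ### Finiteness of contractions and locality of the star product -/

theorem constantCoeff_shiftS (v : Var d) : constantCoeff (shiftS d v) = 0 := by
  rcases v with k | k <;> simp [shiftS]

theorem constantCoeff_shiftT (v : Var d) : constantCoeff (shiftT d v) = 0 := by
  rcases v with k | k <;> simp [shiftT]

theorem isLocal_shiftS : IsLocal fun f : Series d => subst (shiftS d) f :=
  IsLocal.subst constantCoeff_shiftS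

theorem isLocal_shiftT : IsLocal fun f : Series d => subst (shiftT d) f :=
  IsLocal.subst constantCoeff_shiftT

theorem coeff_eq_zero_of_pderiv_eq_zero {σ : Type*} {F : MvPowerSeries σ ℂ} {i : σ}
    (h : pderiv ℂ i F = 0) {n : σ →₀ ℕ} (hn : n i ≠ 0) : coeff n F = 0 := by
  have hle : Finsupp.single i 1 ≤ n := Finsupp.single_le_iff.2 (Nat.one_le_iff_ne_zero.2 hn)
  have := coeff_pderiv (i := i) F (n - Finsupp.single i 1)
  rw [h, map_zero, tsub_add_cancel_of_le hle] at this
  refine (mul_eq_zero.1 this.symm).resolve_right ?_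
  exact Nat.cast_add_one_ne_zero _

theorem eq_zero_of_coeff_shiftS_ne_zero {f : Series d} {m : Var d →₀ ℕ} {α β : Osc d →₀ ℕ}
    (h : coeff (Finsupp.sumElim m (Finsupp.sumElim α β)) (subst (shiftS d) f) ≠ 0) : β = 0 := by
  by_contra hβ
  obtain ⟨k, hk⟩ := Finsupp.ne_iff.1 hβ
  refine h (coeff_eq_zero_of_pderiv_eq_zero (i := Sum.inr (Sum.inr k)) ?_ (by simpa using hk))
  refine ((IsLocal.pderiv _).comp isLocal_shiftS).eq_zero_of_coe (fun p => ?_) f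
  rw [subst_shiftS_coe, pderiv_coe, pderiv_T_polyShiftS, MvPolynomial.coe_zero]

theorem eq_zero_of_coeff_shiftT_ne_zero {f : Series d} {m : Var d →₀ ℕ} {α β : Osc d →₀ ℕ}
    (h : coeff (Finsupp.sumElim m (Finsupp.sumElim α β)) (subst (shiftT d) f) ≠ 0) : α = 0 := by
  by_contra hα
  obtain ⟨k, hk⟩ := Finsupp.ne_iff.1 hα
  refine h (coeff_eq_zero_of_pderiv_eq_zero (i := Sum.inr (Sum.inl k)) ?_ (by simpa using hk))
  refine ((IsLocal.pderiv _).comp isLocal_shiftT).eq_zero_of_coe (fun p => ?_) f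
  rw [subst_shiftT_coe, pderiv_coe, pderiv_S_polyShiftT, MvPolynomial.coe_zero]

theorem degree_eq_of_moment_ne_zero {α β : Osc d →₀ ℕ} (h : moment α β ≠ 0) :
    α.degree = β.degree := by
  rw [moment_eq_prod, Finset.prod_ne_zero_iff] at h
  have hk (k : Osc d) : α k = β (bar k) := by
    by_contra hne
    exact h k (Finset.mem_univ _) (if_neg fun h' => hne h'.symm)
  rw [Finsupp.degree_eq_sum, Finsupp.degree_eq_sum, Finset.sum_congr rfl fun k _ => hk k]
  exact Equiv.sum_comp (Function.Involutive.toPerm bar bar_bar) fun k => β k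

theorem exists_of_starTerm_ne_zero {f g : Series d} {m : Var d →₀ ℕ}
    {p : (Osc d →₀ ℕ) × (Osc d →₀ ℕ)} (h : starTerm f g m p ≠ 0) :
    p.1.degree = p.2.degree ∧ ∃ m₁ m₂ : Var d →₀ ℕ, m₁ + m₂ = m ∧
      coeff (Finsupp.sumElim m₁ (Finsupp.sumElim p.1 0)) (subst (shiftS d) f) ≠ 0 ∧
      coeff (Finsupp.sumElim m₂ (Finsupp.sumElim 0 p.2)) (subst (shiftT d) g) ≠ 0 := by
  classical
  obtain ⟨α, β⟩ := p
  refine ⟨degree_eq_of_moment_ne_zero (right_ne_zero_of_mul h), ?_⟩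
  have hc := left_ne_zero_of_mul h
  rw [integrand, coeff_mul] at hc
  obtain ⟨⟨a, b⟩, hp, hne⟩ := Finset.exists_ne_zero_of_sum_ne_zero hc
  have hab := Finset.HasAntidiagonal.mem_antidiagonal.1 hp
  obtain ⟨m₁, a, rfl⟩ := exists_sumElim a
  obtain ⟨α₁, β₁, rfl⟩ := exists_sumElim a
  obtain ⟨m₂, b, rfl⟩ := exists_sumElim b
  obtain ⟨α₂, β₂, rfl⟩ := exists_sumElim b
  have h1 := left_ne_zero_of_mul hne
  have h2 := right_ne_zero_of_mul hne
  obtain rfl := eq_zero_of_coeff_shiftS_ne_zero h1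
  obtain rfl := eq_zero_of_coeff_shiftT_ne_zero h2
  simp only [← Finsupp.sumElim_add, sumElim_eq_iff, add_zero, zero_add] at hab
  obtain ⟨rfl, rfl, rfl⟩ := hab
  exact ⟨m₁, m₂, rfl, h1, h2⟩

theorem excess_sumElim (m : Var d →₀ ℕ) (α β : Osc d →₀ ℕ) :
    excess d (Finsupp.sumElim m (Finsupp.sumElim α β)) = α.degree + β.degree - m.degree := by
  rw [excess, Finsupp.weight_eq_sum, Fintype.sum_sum_type, Fintype.sum_sum_type,
    Finsupp.degree_eq_sum, Finsupp.degree_eq_sum, Finsupp.degree_eq_sum]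
  simp
  ring

theorem degree_sumElim {σ τ : Type*} [Fintype σ] [Fintype τ] (a : σ →₀ ℕ) (b : τ →₀ ℕ) :
    (Finsupp.sumElim a b).degree = a.degree + b.degree := by
  simp [Finsupp.degree_eq_sum]

/-- The excess bound on the shifted `g` controls the `S`-degree by `m.degree + N`. The `T`-degree
equals it wherever the moment is nonzero, so the bound does not depend on `f`. -/
theorem Banded.exists_degree_left {g : Series d} (hg : Banded g) (m : Var d →₀ ℕ) :
    ∃ K : ℕ, ∀ f p, starTerm g f m p ≠ 0 → p.1.degree ≤ K ∧ p.2.degree ≤ K := by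
  obtain ⟨N, hN, -⟩ := hg
  refine ⟨m.degree + N.toNat, fun f p h => ?_⟩
  obtain ⟨hp, m₁, m₂, rfl, h1, -⟩ := exists_of_starTerm_ne_zero h
  have := hN _ h1
  rw [excess_sumElim] at this
  simp only [map_zero, Nat.cast_zero, add_zero] at this
  rw [map_add]
  omega

theorem Banded.exists_degree_right {g : Series d} (hg : Banded g) (m : Var d →₀ ℕ) :
    ∃ K : ℕ, ∀ f p, starTerm f g m p ≠ 0 → p.1.degree ≤ K ∧ p.2.degree ≤ K := by
  obtain ⟨N, -, hN⟩ := hg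
  refine ⟨m.degree + N.toNat, fun f p h => ?_⟩
  obtain ⟨hp, m₁, m₂, rfl, -, h2⟩ := exists_of_starTerm_ne_zero h
  have := hN _ h2
  rw [excess_sumElim] at this
  simp only [map_zero, Nat.cast_zero, zero_add] at this
  rw [map_add]
  omega

theorem finite_of_degree_le {s : Set ((Osc d →₀ ℕ) × (Osc d →₀ ℕ))} {K : ℕ}
    (h : ∀ p ∈ s, p.1.degree ≤ K ∧ p.2.degree ≤ K) : s.Finite :=
  ((Finsupp.finite_of_degree_le K).prod (Finsupp.finite_of_degree_le K)).subset
    fun p hp => h p hp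

theorem Banded.starDefined_left {g : Series d} (hg : Banded g) (f : Series d) :
    StarDefined g f := fun m =>
  have ⟨_, hK⟩ := hg.exists_degree_left m
  finite_of_degree_le fun p hp => hK f p hp

theorem Banded.starDefined_right {g : Series d} (hg : Banded g) (f : Series d) :
    StarDefined f g := fun m =>
  have ⟨_, hK⟩ := hg.exists_degree_right m
  finite_of_degree_le fun p hp => hK f p hp

theorem coeff_starMul (f g : Series d) (m : Var d →₀ ℕ) :
    coeff m (starMul f g) = ∑ᶠ p, starTerm f g m p := rfl

theorem starMul_add_left {f f' g : Series d} (h : StarDefined f g) (h' : StarDefined f' g) :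
    starMul (f + f') g = starMul f g + starMul f' g := by
  ext m
  rw [map_add, coeff_starMul, coeff_starMul, coeff_starMul, ← finsum_add_distrib (h m) (h' m)]
  simp [starTerm, integrand, subst_add (hasSubst_shiftS d), add_mul]

theorem starMul_add_right {f g g' : Series d} (h : StarDefined f g) (h' : StarDefined f g') :
    starMul f (g + g') = starMul f g + starMul f g' := by
  ext m
  rw [map_add, coeff_starMul, coeff_starMul, coeff_starMul, ← finsum_add_distrib (h m) (h' m)]
  simp [starTerm, integrand, subst_add (hasSubst_shiftT d), mul_add, add_mul]

theorem starMul_smul_left (c : ℂ) (f g : Series d) : starMul (c • f) g = c • starMul f g := by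
  ext m
  rw [coeff_smul, coeff_starMul, coeff_starMul, mul_finsum]
  simp [starTerm, integrand, subst_smul (hasSubst_shiftS d), mul_assoc]

theorem starMul_smul_right (c : ℂ) (f g : Series d) : starMul f (c • g) = c • starMul f g := by
  ext m
  rw [coeff_smul, coeff_starMul, coeff_starMul, mul_finsum]
  simp [starTerm, integrand, subst_smul (hasSubst_shiftT d), mul_assoc]

/-- Shifting never lowers the total degree, and both the `S`-degree and the `Z, Y`-degree are
bounded at a fixed output monomial. Hence only coefficients of `f` up to degree `m.degree + K`
matter. -/
theorem Banded.isLocal_starMul_right {g : Series d} (hg : Banded g) :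
    IsLocal fun f => starMul f g where
  map_add f f' := starMul_add_left (hg.starDefined_right f) (hg.starDefined_right f')
  map_smul c f := starMul_smul_left c f g
  exists_degree m := by
    obtain ⟨K, hK⟩ := hg.exists_degree_right m
    refine ⟨m.degree + K, fun f hf => finsum_eq_zero_of_forall_eq_zero fun p => ?_⟩
    by_contra h
    obtain ⟨-, m₁, m₂, rfl, h1, -⟩ := exists_of_starTerm_ne_zero h
    refine h1 (coeff_subst_eq_zero constantCoeff_shiftS _ fun n hn => hf n (hn.trans ?_))
    rw [degree_sumElim, degree_sumElim, map_zero, map_add]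
    have := (hK f p h).1
    omega

theorem Banded.isLocal_starMul_left {g : Series d} (hg : Banded g) :
    IsLocal fun f => starMul g f where
  map_add f f' := starMul_add_right (hg.starDefined_left f) (hg.starDefined_left f')
  map_smul c f := starMul_smul_right c g f
  exists_degree m := by
    obtain ⟨K, hK⟩ := hg.exists_degree_left m
    refine ⟨m.degree + K, fun f hf => finsum_eq_zero_of_forall_eq_zero fun p => ?_⟩
    by_contra h
    obtain ⟨-, m₁, m₂, rfl, -, h2⟩ := exists_of_starTerm_ne_zero h
    refine h2 (coeff_subst_eq_zero constantCoeff_shiftT _ fun n hn => hf n (hn.trans ?_))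
    rw [degree_sumElim, degree_sumElim, map_zero, map_add]
    have := (hK f p h).2
    omega

/-- The derivative commutes with the shift, and removing one `Z` or `Y` raises the excess by one. -/
theorem Banded.pderiv {g : Series d} (v : Var d) (hg : Banded g) :
    Banded (MvPowerSeries.pderiv ℂ v g) := by
  obtain ⟨N, hS, hT⟩ := hg
  have key {F : MvPowerSeries (BigVar d) ℂ} (hF : Bounded N F) :
      Bounded (N + 1) (MvPowerSeries.pderiv ℂ (Sum.inl v : BigVar d) F) := fun n hn => by
    rw [coeff_pderiv] at hn
    have := hF _ (left_ne_zero_of_mul hn)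
    rw [map_add, excess, Finsupp.weight_single] at this
    simp only [Sum.elim_inl, one_smul] at this
    rw [excess]
    omega
  refine ⟨N + 1, ?_, ?_⟩
  · rw [← ((IsLocal.pderiv (Sum.inl v : BigVar d)).comp isLocal_shiftS).eq_of_coe
      (isLocal_shiftS.comp (IsLocal.pderiv v)) (fun p => ?_) g]
    · exact key hS
    · rw [subst_shiftS_coe, pderiv_coe, pderiv_coe, subst_shiftS_coe, pderiv_polyShiftS]
  · rw [← ((IsLocal.pderiv (Sum.inl v : BigVar d)).comp isLocal_shiftT).eq_of_coe
      (isLocal_shiftT.comp (IsLocal.pderiv v)) (fun p => ?_) g]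
    · exact key hT
    · rw [subst_shiftT_coe, pderiv_coe, pderiv_coe, subst_shiftT_coe, pderiv_polyShiftT]

theorem Banded.derivP {g : Series d} (k : Osc d) (hg : Banded g) : Banded (derivP k g) :=
  (hg.pderiv (Sum.inr k)).add (hg.pderiv (Sum.inl k))

theorem Banded.derivM {g : Series d} (k : Osc d) (hg : Banded g) : Banded (derivM k g) := by
  simpa [HSStar.derivM, sub_eq_add_neg] using
    (hg.pderiv (Sum.inr k)).add ((hg.pderiv (Sum.inl k)).smul (-1))

theorem Banded.X_mul {g : Series d} (v : Var d) (hg : Banded g) : Banded (X v * g) := by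
  simpa using (Banded.coe (MvPolynomial.X v)).mul hg

/-! ### Star products of banded series -/

/-- The extension is done in two stages: for a polynomial second argument the first is extended,
then for a fixed banded first argument the second is. -/
theorem Banded.eq_of_coe_coe {L L' : Series d → Series d → Series d}
    (h₁ : ∀ f, Banded f → IsLocal (L f)) (h₁' : ∀ f, Banded f → IsLocal (L' f))
    (h₂ : ∀ g, Banded g → IsLocal fun f => L f g) (h₂' : ∀ g, Banded g → IsLocal fun f => L' f g)
    (h : ∀ p q : MvPolynomial (Var d) ℂ, L p q = L' p q) {f : Series d} (hf : Banded f)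
    (g : Series d) : L f g = L' f g :=
  (h₁ f hf).eq_of_coe (h₁' f hf) (fun q =>
    (h₂ q (Banded.coe q)).eq_of_coe (h₂' q (Banded.coe q)) (fun p => h p q) f) g

theorem Banded.starMul_X_mul {f : Series d} (hf : Banded f) (g : Series d) (v : Var d) :
    starMul (X v * f) g = X v * starMul f g +
      kappa (osc v) • starMul f (HSStar.derivM (bar (osc v)) g) :=
  eq_of_coe_coe (L := fun f g => starMul (X v * f) g)
    (L' := fun f g => X v * starMul f g +
      kappa (osc v) • starMul f (HSStar.derivM (bar (osc v)) g))
    (fun _ hf => (hf.X_mul v).isLocal_starMul_left)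
    (fun _ hf => ((IsLocal.mul_left _).comp hf.isLocal_starMul_left).add
      ((hf.isLocal_starMul_left.comp (isLocal_derivM _)).const_smul _))
    (fun _ hg => hg.isLocal_starMul_right.comp (IsLocal.mul_left _))
    (fun _ hg => ((IsLocal.mul_left _).comp hg.isLocal_starMul_right).add
      ((hg.derivM _).isLocal_starMul_right.const_smul _))
    (starMul_X_mul_coe v) hf g

theorem Banded.starMul_mul_X {f : Series d} (hf : Banded f) (g : Series d) (v : Var d) :
    starMul f (X v * g) = X v * starMul f g + (sgn v * kappa (bar (osc v))) •
      starMul (HSStar.derivP (bar (osc v)) f) g :=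
  eq_of_coe_coe (L := fun f g => starMul f (X v * g))
    (L' := fun f g => X v * starMul f g + (sgn v * kappa (bar (osc v))) •
      starMul (HSStar.derivP (bar (osc v)) f) g)
    (fun _ hf => hf.isLocal_starMul_left.comp (IsLocal.mul_left _))
    (fun _ hf => ((IsLocal.mul_left _).comp hf.isLocal_starMul_left).add
      ((hf.derivP _).isLocal_starMul_left.const_smul _))
    (fun _ hg => (hg.X_mul v).isLocal_starMul_right)
    (fun _ hg => ((IsLocal.mul_left _).comp hg.isLocal_starMul_right).add
      ((hg.isLocal_starMul_right.comp (isLocal_derivP _)).const_smul _))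
    (starMul_mul_X_coe v) hf g

theorem Banded.pderiv_starMul {f : Series d} (hf : Banded f) (g : Series d) (v : Var d) :
    MvPowerSeries.pderiv ℂ v (starMul f g) =
      starMul (MvPowerSeries.pderiv ℂ v f) g + starMul f (MvPowerSeries.pderiv ℂ v g) :=
  eq_of_coe_coe (L := fun f g => MvPowerSeries.pderiv ℂ v (starMul f g))
    (L' := fun f g =>
      starMul (MvPowerSeries.pderiv ℂ v f) g + starMul f (MvPowerSeries.pderiv ℂ v g))
    (fun _ hf => (IsLocal.pderiv v).comp hf.isLocal_starMul_left)
    (fun _ hf => (hf.pderiv v).isLocal_starMul_left.add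
      (hf.isLocal_starMul_left.comp (IsLocal.pderiv v)))
    (fun _ hg => (IsLocal.pderiv v).comp hg.isLocal_starMul_right)
    (fun _ hg => (hg.isLocal_starMul_right.comp (IsLocal.pderiv v)).add
      (hg.pderiv v).isLocal_starMul_right)
    (pderiv_starMul_coe v) hf g

theorem Banded.derivM_starMul {f g : Series d} (hf : Banded f) (hg : Banded g) (k : Osc d) :
    HSStar.derivM k (starMul f g) =
      starMul (HSStar.derivM k f) g + starMul f (HSStar.derivM k g) := by
  simp only [HSStar.derivM, Derivation.sub_apply]
  rw [hf.pderiv_starMul, hf.pderiv_starMul, hg.isLocal_starMul_right.map_sub,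
    hf.isLocal_starMul_left.map_sub]
  abel

theorem starMul_one (f : Series d) : starMul f 1 = f := by
  refine IsLocal.eq_of_coe (L := fun f => starMul f 1) ?_ IsLocal.id starMul_coe_one f
  simpa using (Banded.coe (1 : MvPolynomial (Var d) ℂ)).isLocal_starMul_right

theorem one_starMul (f : Series d) : starMul 1 f = f := by
  refine IsLocal.eq_of_coe (L := fun f => starMul 1 f) ?_ IsLocal.id starMul_one_coe f
  simpa using (Banded.coe (1 : MvPolynomial (Var d) ℂ)).isLocal_starMul_left

theorem coe_C_eq_smul_one {σ : Type*} (c : ℂ) :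
    ((MvPolynomial.C c : MvPolynomial σ ℂ) : MvPowerSeries σ ℂ) = c • 1 := by
  rw [MvPolynomial.coe_C, smul_eq_C_mul, mul_one]

/-- Star multiplication by a polynomial is a differential operator with polynomial coefficients, and
these preserve bandedness. -/
theorem Banded.coe_starMul (f : MvPolynomial (Var d) ℂ) {g : Series d} (hg : Banded g) :
    Banded (starMul (f : Series d) g) := by
  induction f using MvPolynomial.induction_on generalizing g with
  | C c =>
    rw [coe_C_eq_smul_one, starMul_smul_left, one_starMul]
    exact hg.smul c
  | add p q hp hq =>
    rw [MvPolynomial.coe_add, hg.isLocal_starMul_right.map_add]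
    exact (hp hg).add (hq hg)
  | mul_X p v hp =>
    rw [mul_comm, MvPolynomial.coe_mul, MvPolynomial.coe_X, (Banded.coe p).starMul_X_mul]
    exact ((hp hg).X_mul v).add ((hp (hg.derivM _)).smul _)

/-- Moving a variable out of the first factor leaves derivative terms on `g` and on `h` on one side,
and on `g * h` on the other; they match because `derivM` is a derivation of the star product. -/
theorem coe_starMul_starMul (f : MvPolynomial (Var d) ℂ) {g h : Series d} (hg : Banded g)
    (hh : Banded h) :
    starMul (starMul (f : Series d) g) h = starMul (f : Series d) (starMul g h) := by
  induction f using MvPolynomial.induction_on generalizing g h with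
  | C c =>
    rw [coe_C_eq_smul_one, starMul_smul_left, one_starMul, starMul_smul_left, starMul_smul_left,
      one_starMul]
  | add p q hp hq =>
    rw [MvPolynomial.coe_add, hg.isLocal_starMul_right.map_add, hh.isLocal_starMul_right.map_add,
      hp hg hh, hq hg hh, starMul_add_left ((Banded.coe p).starDefined_left _)
      ((Banded.coe q).starDefined_left _)]
  | mul_X p v hp =>
    have hpg := hg.coe_starMul p
    rw [mul_comm, MvPolynomial.coe_mul, MvPolynomial.coe_X, (Banded.coe p).starMul_X_mul,
      (Banded.coe p).starMul_X_mul, hh.isLocal_starMul_right.map_add, hpg.starMul_X_mul,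
      hh.isLocal_starMul_right.map_smul, hp hg hh, hp (hg.derivM _) hh,
      hp hg (hh.derivM _), hg.derivM_starMul hh, (Banded.coe p).isLocal_starMul_left.map_add,
      smul_add, add_comm (kappa _ • _), add_assoc]

/-- Star multiplication is associative on banded series as soon as the products are banded. -/
theorem Banded.starMul_assoc_of_right {g h : Series d} (hg : Banded g) (hh : Banded h)
    (hgh : Banded (starMul g h)) (f : Series d) :
    starMul (starMul f g) h = starMul f (starMul g h) :=
  (hh.isLocal_starMul_right.comp hg.isLocal_starMul_right).eq_of_coe hgh.isLocal_starMul_right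
    (fun p => coe_starMul_starMul p hg hh) f

/-- Both sides are local in `h`. For polynomial `h` the previous lemma applies with `f` as its
unrestricted argument, which is why `g * p` has to be banded. -/
theorem Banded.starMul_assoc_of_left {f g : Series d} (hf : Banded f) (hg : Banded g)
    (hfg : Banded (starMul f g))
    (hp : ∀ p : MvPolynomial (Var d) ℂ, Banded (starMul g p)) (h : Series d) :
    starMul (starMul f g) h = starMul f (starMul g h) :=
  hfg.isLocal_starMul_left.eq_of_coe (hf.isLocal_starMul_left.comp hg.isLocal_starMul_left)
    (fun p => hg.starMul_assoc_of_right (Banded.coe p) (hp p) f) h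

theorem Banded.starMul_assoc_of_outer {f h : Series d} (hf : Banded f) (hh : Banded h)
    (hp : ∀ p : MvPolynomial (Var d) ℂ, Banded (starMul p h)) (g : Series d) :
    starMul (starMul f g) h = starMul f (starMul g h) :=
  (hh.isLocal_starMul_right.comp hf.isLocal_starMul_left).eq_of_coe
    (hf.isLocal_starMul_left.comp hh.isLocal_starMul_right)
    (fun p => (Banded.coe p).starMul_assoc_of_right hh (hp p) f) g

/-! ### Power series in `z_i y^i` -/

/-- The lowered components `V_A`. -/
def vLow (V : Fin (d + 1) → ℝ) (A : Fin (d + 1)) : ℂ := ((eta d A * V A : ℝ) : ℂ)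

/-- The combination `y_i - z_i`. -/
def qVec (V : Fin (d + 1) → ℝ) (i : Fin 2) : Series d :=
  ∑ A, vLow V A • (X (Sum.inr (A, i)) - X (Sum.inl (A, i)))

/-- The combination `y_i + z_i`. -/
def pVec (V : Fin (d + 1) → ℝ) (i : Fin 2) : Series d :=
  ∑ A, vLow V A • (X (Sum.inr (A, i)) + X (Sum.inl (A, i)))

theorem zy_eq_sum (V : Fin (d + 1) → ℝ) : zy V =
    (∑ A, vLow V A • X (Sum.inl (A, 0))) * (∑ A, vLow V A • X (Sum.inr (A, 1))) -
      (∑ A, vLow V A • X (Sum.inl (A, 1))) * (∑ A, vLow V A • X (Sum.inr (A, 0))) := by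
  simp only [zy, vLow, smul_eq_C_mul]

/-- In these combinations one of the two contractions always cancels, and `derivP` annihilates
`qVec`. -/
theorem zy_eq (V : Fin (d + 1) → ℝ) :
    zy V = (1 / 2 : ℂ) • (pVec V 0 * qVec V 1 - pVec V 1 * qVec V 0) := by
  have hp (i : Fin 2) : pVec V i = (∑ A, vLow V A • X (Sum.inr (A, i))) +
      ∑ A, vLow V A • X (Sum.inl (A, i)) := by
    simp [pVec, smul_add, Finset.sum_add_distrib]
  have hq (i : Fin 2) : qVec V i = (∑ A, vLow V A • X (Sum.inr (A, i))) -
      ∑ A, vLow V A • X (Sum.inl (A, i)) := by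
    simp [qVec, smul_sub, Finset.sum_sub_distrib]
  rw [one_div, eq_inv_smul_iff₀ (two_ne_zero' ℂ), hp, hp, hq, hq, zy_eq_sum, two_smul]
  ring

/-- `z_i y^i` as a polynomial. -/
def polyZY (V : Fin (d + 1) → ℝ) : MvPolynomial (Var d) ℂ :=
  (∑ A, vLow V A • MvPolynomial.X (Sum.inl (A, 0))) *
      (∑ A, vLow V A • MvPolynomial.X (Sum.inr (A, 1))) -
    (∑ A, vLow V A • MvPolynomial.X (Sum.inl (A, 1))) *
      (∑ A, vLow V A • MvPolynomial.X (Sum.inr (A, 0)))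

theorem coe_polyZY (V : Fin (d + 1) → ℝ) : (polyZY V : Series d) = zy V := by
  have (f : Fin (d + 1) → Var d) : ((∑ A, vLow V A • MvPolynomial.X (f A) :
      MvPolynomial (Var d) ℂ) : Series d) = ∑ A, vLow V A • X (f A) := by
    rw [← MvPolynomial.coeToMvPowerSeries.ringHom_apply, map_sum]
    simp
  rw [polyZY, coe_sub', MvPolynomial.coe_mul, MvPolynomial.coe_mul, this, this, this, this, zy_eq_sum]

theorem derivP_qVec (V : Fin (d + 1) → ℝ) (k : Osc d) (i : Fin 2) : derivP k (qVec V i) = 0 := by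
  classical
  simp only [qVec, map_sum, Derivation.map_smul]
  refine Finset.sum_eq_zero fun A _ => ?_
  simp [derivP, pderiv_X, Pi.single_apply]

theorem derivP_pVec (V : Fin (d + 1) → ℝ) (k : Osc d) (i : Fin 2) :
    derivP k (pVec V i) = if k.2 = i then (2 * vLow V k.1) • 1 else 0 := by
  classical
  obtain ⟨A, j⟩ := k
  simp only [pVec, map_sum, Derivation.map_smul]
  rw [Finset.sum_eq_single A]
  · by_cases h : j = i
    · simp [derivP, h, two_mul, add_smul]
    · simp [derivP, h, Ne.symm h]
  · intro B _ hB
    simp [derivP, hB]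
  · simp

/-- The sign `ε^{12} = 1`, `ε^{21} = -1`. -/
def eps (i : Fin 2) : ℂ := if i = 0 then 1 else -1

theorem derivP_zy (V : Fin (d + 1) → ℝ) (k : Osc d) :
    derivP k (zy V) = (eps k.2 * vLow V k.1) • qVec V k.2.rev := by
  obtain ⟨A, j⟩ := k
  rw [zy_eq, Derivation.map_smul, map_sub, Derivation.leibniz, Derivation.leibniz, derivP_qVec,
    derivP_qVec, derivP_pVec, derivP_pVec]
  have h0 : (0 : Fin 2).rev = 1 := rfl
  have h1 : (1 : Fin 2).rev = 0 := rfl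
  fin_cases j <;> simp [eps, h0, h1, smul_smul]

theorem kappa_eq (k : Osc d) : kappa k = eps k.2 * eta d k.1 / 2 := by
  unfold kappa eps; split_ifs <;> ring

/-- The power series `∑ a_n (z_i y^i)^n`. -/
def powSum (V : Fin (d + 1) → ℝ) (a : ℕ → ℂ) : Series d := fun m =>
  ∑ n ∈ Finset.range (m.degree + 1), a n * coeff m (zy V ^ n)

theorem coeff_powSum (V : Fin (d + 1) → ℝ) (a : ℕ → ℂ) (m : Var d →₀ ℕ) :
    coeff m (powSum V a) = ∑ n ∈ Finset.range (m.degree + 1), a n * coeff m (zy V ^ n) := rfl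

/-- The truncation in `powSum` therefore discards nothing. -/
theorem coeff_zy_pow_eq_zero (V : Fin (d + 1) → ℝ) {m : Var d →₀ ℕ} {n : ℕ} (h : m.degree < n) :
    coeff m (zy V ^ n) = 0 := by
  refine coeff_of_lt_order (lt_of_lt_of_le (by exact_mod_cast h)
    (le_order_pow_of_constantCoeff_eq_zero n ?_))
  simp [zy]

theorem sum_range_mul_coeff_zy_pow (V : Fin (d + 1) → ℝ) (a : ℕ → ℂ) {m : Var d →₀ ℕ} {K : ℕ}
    (h : m.degree < K) : ∑ n ∈ Finset.range K, a n * coeff m (zy V ^ n) =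
      ∑ n ∈ Finset.range (m.degree + 1), a n * coeff m (zy V ^ n) := by
  symm
  refine Finset.sum_subset (Finset.range_mono h) fun n _ hn => ?_
  rw [coeff_zy_pow_eq_zero V (by simpa [Nat.lt_succ_iff] using hn), mul_zero]

/-- Local maps act on `powSum` term by term, with a cutoff uniform in the coefficient sequence. -/
theorem IsLocal.exists_coeff_powSum {τ : Type*} {L : Series d → MvPowerSeries τ ℂ}
    (hL : IsLocal L) (V : Fin (d + 1) → ℝ) (m : τ →₀ ℕ) : ∃ K₀, ∀ K, K₀ ≤ K → ∀ a,
      coeff m (L (powSum V a)) = ∑ n ∈ Finset.range K, a n * coeff m (L (zy V ^ n)) := by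
  obtain ⟨N, hN⟩ := hL.exists_coeff_eq m
  refine ⟨N + 1, fun K hK a => ?_⟩
  rw [hN _ (∑ n ∈ Finset.range K, a n • zy V ^ n) fun n hn => ?_]
  · rw [hL.map_sum, _root_.map_sum]
    simp [hL.map_smul]
  · rw [coeff_powSum, _root_.map_sum, ← sum_range_mul_coeff_zy_pow V a (hn.trans_lt hK)]
    simp

theorem powSum_add (V : Fin (d + 1) → ℝ) (a b : ℕ → ℂ) :
    powSum V (a + b) = powSum V a + powSum V b := by
  ext m
  simp [coeff_powSum, add_mul, Finset.sum_add_distrib]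

/-- The coefficients of the derivative of a power series. -/
def shiftSeq (a : ℕ → ℂ) : ℕ → ℂ := fun n => (n + 1) * a (n + 1)

theorem derivation_powSum (V : Fin (d + 1) → ℝ) (D : Derivation ℂ (Series d) (Series d))
    (hD : IsLocal D) (a : ℕ → ℂ) : D (powSum V a) = D (zy V) * powSum V (shiftSeq a) := by
  ext m
  obtain ⟨K₁, h₁⟩ := hD.exists_coeff_powSum V m
  obtain ⟨K₂, h₂⟩ := (IsLocal.mul_left (D (zy V))).exists_coeff_powSum V m
  -- One extra term on the left: `D` kills the constant term, and the remaining indices shift by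
  -- one.
  rw [h₁ (max K₁ K₂ + 1) (by omega), h₂ (max K₁ K₂) (by omega), Finset.sum_range_succ']
  rw [pow_zero, Derivation.map_one_eq_zero, map_zero, mul_zero, add_zero]
  refine Finset.sum_congr rfl fun n _ => ?_
  rw [Derivation.leibniz_pow, Nat.add_sub_cancel, smul_eq_mul, ← Nat.cast_smul_eq_nsmul ℂ,
    coeff_smul, shiftSeq, mul_comm (D (zy V))]
  push_cast
  ring

theorem bounded_shiftS_zy (V : Fin (d + 1) → ℝ) : Bounded 0 (subst (shiftS d) (zy V)) := by
  let l (f : Fin (d + 1) → BigVar d) : MvPowerSeries (BigVar d) ℂ :=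
    ∑ A, C (vLow V A) * X (f A)
  have hl {N : ℤ} {f : Fin (d + 1) → BigVar d}
      (hf : ∀ A, (Sum.elim (fun _ => -1) (fun _ => 1) (f A) : ℤ) ≤ N) : Bounded N (l f) :=
    Bounded.sum _ fun A _ => (Bounded.C_mul_X _ _).mono (hf A)
  let z (i : Fin 2) := l fun A => Sum.inl (Sum.inl (A, i))
  let y (i : Fin 2) := l fun A => Sum.inl (Sum.inr (A, i))
  let s (i : Fin 2) := l fun A => Sum.inr (Sum.inl (A, i))
  have hz (i : Fin 2) : Bounded (-1) (z i) := hl fun A => by simp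
  have hy (i : Fin 2) : Bounded (-1) (y i) := hl fun A => by simp
  have hs (i : Fin 2) : Bounded 1 (s i) := hl fun A => by simp
  -- The terms `s 0 * s 1` and `s 1 * s 0`, the only ones of positive excess, cancel.
  have h : subst (shiftS d) (zy V) = z 0 * y 1 - z 1 * y 0 + z 0 * s 1 - z 1 * s 0 +
      s 0 * y 1 - s 1 * y 0 := by
    have hX := subst_X (R := ℂ) (hasSubst_shiftS d)
    have : subst (shiftS d) (zy V) = (z 0 + s 0) * (y 1 + s 1) - (z 1 + s 1) * (y 0 + s 0) := by
      rw [zy_eq_sum, ← coe_substAlgHom (hasSubst_shiftS d)]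
      simp only [map_sub, map_mul, map_sum, map_smul]
      simp only [coe_substAlgHom, hX, shiftS, smul_add, Finset.sum_add_distrib]
      simp only [z, y, s, l, ← smul_eq_C_mul]
    rw [this]
    ring
  rw [h]
  refine Bounded.sub (Bounded.add (Bounded.sub (Bounded.add (Bounded.sub ?_ ?_) ?_) ?_) ?_) ?_
  exacts [((hz 0).mul (hy 1)).mono (by norm_num), ((hz 1).mul (hy 0)).mono (by norm_num),
    (hz 0).mul (hs 1), (hz 1).mul (hs 0), (hs 0).mul (hy 1), (hs 1).mul (hy 0)]

theorem bounded_shiftT_zy (V : Fin (d + 1) → ℝ) : Bounded 0 (subst (shiftT d) (zy V)) := by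
  let l (f : Fin (d + 1) → BigVar d) : MvPowerSeries (BigVar d) ℂ :=
    ∑ A, C (vLow V A) * X (f A)
  have hl {N : ℤ} {f : Fin (d + 1) → BigVar d}
      (hf : ∀ A, (Sum.elim (fun _ => -1) (fun _ => 1) (f A) : ℤ) ≤ N) : Bounded N (l f) :=
    Bounded.sum _ fun A _ => (Bounded.C_mul_X _ _).mono (hf A)
  let z (i : Fin 2) := l fun A => Sum.inl (Sum.inl (A, i))
  let y (i : Fin 2) := l fun A => Sum.inl (Sum.inr (A, i))
  let t (i : Fin 2) := l fun A => Sum.inr (Sum.inr (A, i))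
  have hz (i : Fin 2) : Bounded (-1) (z i) := hl fun A => by simp
  have hy (i : Fin 2) : Bounded (-1) (y i) := hl fun A => by simp
  have ht (i : Fin 2) : Bounded 1 (t i) := hl fun A => by simp
  -- Again the terms quadratic in `t` cancel.
  have h : subst (shiftT d) (zy V) = z 0 * y 1 - z 1 * y 0 + z 0 * t 1 - z 1 * t 0 -
      t 0 * y 1 + t 1 * y 0 := by
    have hX := subst_X (R := ℂ) (hasSubst_shiftT d)
    have : subst (shiftT d) (zy V) = (z 0 - t 0) * (y 1 + t 1) - (z 1 - t 1) * (y 0 + t 0) := by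
      rw [zy_eq_sum, ← coe_substAlgHom (hasSubst_shiftT d)]
      simp only [map_sub, map_mul, map_sum, map_smul]
      simp only [coe_substAlgHom, hX, shiftT, smul_add, smul_sub, Finset.sum_add_distrib,
        Finset.sum_sub_distrib]
      simp only [z, y, t, l, ← smul_eq_C_mul]
    rw [this]
    ring
  rw [h]
  refine Bounded.add (Bounded.sub (Bounded.sub (Bounded.add (Bounded.sub ?_ ?_) ?_) ?_) ?_) ?_
  exacts [((hz 0).mul (hy 1)).mono (by norm_num), ((hz 1).mul (hy 0)).mono (by norm_num),
    (hz 0).mul (ht 1), (hz 1).mul (ht 0), (ht 0).mul (hy 1), (ht 1).mul (hy 0)]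

theorem IsLocal.bounded_powSum {L : Series d → MvPowerSeries (BigVar d) ℂ} (hL : IsLocal L)
    (V : Fin (d + 1) → ℝ) {N : ℤ} (h : ∀ n, Bounded N (L (zy V ^ n))) (a : ℕ → ℂ) :
    Bounded N (L (powSum V a)) := fun m hm => by
  obtain ⟨K, hK⟩ := hL.exists_coeff_powSum V m
  rw [hK K le_rfl] at hm
  obtain ⟨n, -, hn⟩ := Finset.exists_ne_zero_of_sum_ne_zero hm
  exact h n m (right_ne_zero_of_mul hn)

theorem banded_powSum (V : Fin (d + 1) → ℝ) (a : ℕ → ℂ) : Banded (powSum V a) := by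
  refine ⟨0, isLocal_shiftS.bounded_powSum V (fun n => ?_) a,
    isLocal_shiftT.bounded_powSum V (fun n => ?_) a⟩
  · rw [subst_pow (hasSubst_shiftS d)]
    exact (bounded_shiftS_zy V).pow n
  · rw [subst_pow (hasSubst_shiftT d)]
    exact (bounded_shiftT_zy V).pow n

/-! ### Star products with power series in `z_i y^i` -/

/-- In the right factor the contractions of `Z` and `Y` have opposite signs, so they add up in `y -
z` and cancel in `y + z`. In the left factor the signs agree and `y - z` passes through freely. -/
theorem Banded.starMul_qVec_mul {f : Series d} (hf : Banded f) (g : Series d)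
    (V : Fin (d + 1) → ℝ) (i : Fin 2) :
    starMul f (qVec V i * g) = qVec V i * starMul f g +
      ∑ A, (vLow V A * (2 * kappa (A, i.rev))) • starMul (HSStar.derivP (A, i.rev) f) g := by
  rw [qVec, Finset.sum_mul, hf.isLocal_starMul_left.map_sum, Finset.sum_mul,
    ← Finset.sum_add_distrib]
  refine Finset.sum_congr rfl fun A _ => ?_
  rw [smul_mul_assoc, hf.isLocal_starMul_left.map_smul, sub_mul, hf.isLocal_starMul_left.map_sub,
    hf.starMul_mul_X, hf.starMul_mul_X, smul_mul_assoc, sub_mul]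
  simp only [osc, Sum.elim_inl, Sum.elim_inr, id, sgn, bar]
  module

theorem Banded.starMul_pVec_mul {f : Series d} (hf : Banded f) (g : Series d)
    (V : Fin (d + 1) → ℝ) (i : Fin 2) :
    starMul f (pVec V i * g) = pVec V i * starMul f g := by
  rw [pVec, Finset.sum_mul, hf.isLocal_starMul_left.map_sum, Finset.sum_mul]
  refine Finset.sum_congr rfl fun A _ => ?_
  rw [smul_mul_assoc, hf.isLocal_starMul_left.map_smul, add_mul, hf.isLocal_starMul_left.map_add,
    hf.starMul_mul_X, hf.starMul_mul_X, smul_mul_assoc, add_mul]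
  simp only [osc, Sum.elim_inl, Sum.elim_inr, id, sgn, bar]
  module

theorem Banded.qVec_mul_starMul {f g : Series d} (hf : Banded f) (hg : Banded g)
    (V : Fin (d + 1) → ℝ) (i : Fin 2) :
    starMul (qVec V i * f) g = qVec V i * starMul f g := by
  rw [qVec, Finset.sum_mul, hg.isLocal_starMul_right.map_sum, Finset.sum_mul]
  refine Finset.sum_congr rfl fun A _ => ?_
  rw [smul_mul_assoc, hg.isLocal_starMul_right.map_smul, sub_mul,
    hg.isLocal_starMul_right.map_sub, hf.starMul_X_mul, hf.starMul_X_mul, smul_mul_assoc, sub_mul]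
  simp only [osc, Sum.elim_inl, Sum.elim_inr, id]
  module

theorem derivP_powSum_starMul (V : Fin (d + 1) → ℝ) (a : ℕ → ℂ) {g : Series d} (hg : Banded g)
    (k : Osc d) : starMul (derivP k (powSum V a)) g =
      (eps k.2 * vLow V k.1) • (qVec V k.2.rev * starMul (powSum V (shiftSeq a)) g) := by
  rw [derivation_powSum V _ (isLocal_derivP k), derivP_zy, smul_mul_assoc, starMul_smul_left,
    (banded_powSum V _).qVec_mul_starMul hg]

/-- Contracting `q` differentiates `F(zy)`, which produces `q F'(zy)`. The accumulated scalar is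
`V^A V_A = 1`. -/
theorem powSum_starMul_qVec_mul {V : Fin (d + 1) → ℝ} (hV : ∑ A, eta d A * V A * V A = 1)
    (a : ℕ → ℂ) {g : Series d} (hg : Banded g) (i : Fin 2) :
    starMul (powSum V a) (qVec V i * g) =
      qVec V i * starMul (powSum V (a + shiftSeq a)) g := by
  rw [(banded_powSum V a).starMul_qVec_mul, powSum_add, hg.isLocal_starMul_right.map_add, mul_add]
  congr 1
  simp only [derivP_powSum_starMul V a hg, Fin.rev_rev, smul_smul, kappa_eq]
  rw [← Finset.sum_smul]
  have (A : Fin (d + 1)) : vLow V A * (2 * (eps i.rev * eta d A / 2)) * (eps i.rev * vLow V A) =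
      ((eta d A * V A * V A : ℝ) : ℂ) := by
    have h1 : eps i.rev * eps i.rev = 1 := by unfold eps; split_ifs <;> norm_num
    have h2 : (eta d A : ℂ) * eta d A = 1 := by unfold eta; split_ifs <;> simp
    simp only [vLow]
    push_cast
    linear_combination (eta d A * V A * (V A) * (eta d A : ℂ) * eta d A) * h1 +
      (eta d A * V A * V A : ℂ) * h2
  rw [Finset.sum_congr rfl fun A _ => this A, ← Complex.ofReal_sum, hV, Complex.ofReal_one,
    one_smul]

/-- Each term of `z_i y^i` has one factor `p`, which passes through, and one factor `q`, which
replaces `F` by `F + F'`. -/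
theorem powSum_starMul_zy_mul {V : Fin (d + 1) → ℝ} (hV : ∑ A, eta d A * V A * V A = 1)
    (a : ℕ → ℂ) {g : Series d} (hg : Banded g) :
    starMul (powSum V a) (zy V * g) = zy V * starMul (powSum V (a + shiftSeq a)) g := by
  have hL := (banded_powSum V a).isLocal_starMul_left
  have h := zy_eq V
  rw [h, smul_mul_assoc, hL.map_smul, sub_mul, hL.map_sub, mul_assoc, mul_assoc,
    (banded_powSum V a).starMul_pVec_mul, (banded_powSum V a).starMul_pVec_mul,
    powSum_starMul_qVec_mul hV a hg, powSum_starMul_qVec_mul hV a hg, smul_mul_assoc, sub_mul,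
    mul_assoc, mul_assoc]

theorem banded_zy_pow (V : Fin (d + 1) → ℝ) (n : ℕ) : Banded (zy V ^ n) := by
  rw [← coe_polyZY, ← MvPolynomial.coe_pow]
  exact Banded.coe _

theorem powSum_starMul_zy_pow {V : Fin (d + 1) → ℝ} (hV : ∑ A, eta d A * V A * V A = 1)
    (a : ℕ → ℂ) (n : ℕ) : starMul (powSum V a) (zy V ^ n) =
      zy V ^ n * powSum V ((fun b => b + shiftSeq b)^[n] a) := by
  induction n generalizing a with
  | zero => simp [starMul_one]
  | succ n ih =>
    rw [pow_succ', powSum_starMul_zy_mul hV a (banded_zy_pow V n), ih, mul_assoc,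
      Function.iterate_succ_apply]

theorem coeff_zy_pow_mul_powSum (V : Fin (d + 1) → ℝ) (a : ℕ → ℂ) (n : ℕ) {m : Var d →₀ ℕ}
    {K : ℕ} (hK : m.degree < K) : coeff m (zy V ^ n * powSum V a) =
      ∑ j ∈ Finset.range K, a j * coeff m (zy V ^ (n + j)) := by
  obtain ⟨K₀, h⟩ := (IsLocal.mul_left (zy V ^ n)).exists_coeff_powSum V m
  rw [h (max K₀ K) (le_max_left _ _)]
  simp only [← pow_add]
  symm
  refine Finset.sum_subset (Finset.range_mono (le_max_right _ _)) fun j _ hj => ?_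
  rw [Finset.mem_range, not_lt] at hj
  rw [coeff_zy_pow_eq_zero V (by omega), mul_zero]

theorem coeff_powSum_starMul_powSum {V : Fin (d + 1) → ℝ} (hV : ∑ A, eta d A * V A * V A = 1)
    (a b : ℕ → ℂ) (m : Var d →₀ ℕ) : ∃ K, m.degree < K ∧
      coeff m (starMul (powSum V a) (powSum V b)) =
        ∑ n ∈ Finset.range K, ∑ j ∈ Finset.range K,
          b n * (fun b => b + shiftSeq b)^[n] a j * coeff m (zy V ^ (n + j)) := by
  obtain ⟨K, h⟩ := (banded_powSum V a).isLocal_starMul_left.exists_coeff_powSum V m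
  refine ⟨max K (m.degree + 1), by omega, ?_⟩
  rw [h _ (le_max_left _ _)]
  refine Finset.sum_congr rfl fun n _ => ?_
  rw [powSum_starMul_zy_pow hV, coeff_zy_pow_mul_powSum V _ n (K := max K (m.degree + 1))
    (by omega), Finset.mul_sum]
  simp only [mul_assoc]

/-! ### Regular functions -/

/-- The value of a complex polynomial at a real point. -/
def evalReal {n : ℕ} (φ : MvPolynomial (Fin n) ℂ) (τ : Fin n → ℝ) : ℂ :=
  MvPolynomial.eval (fun i => (τ i : ℂ)) φ

theorem continuous_evalReal {n : ℕ} (φ : MvPolynomial (Fin n) ℂ) : Continuous (evalReal φ) :=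
  (MvPolynomial.continuous_eval φ).comp
    (continuous_pi fun i => Complex.continuous_ofReal.comp (continuous_apply i))

/-- The coefficients of `∫_M ρ exp(φ x) dμ` as a power series in `x`. -/
def expMoment {n : ℕ} (μ : Measure (Fin n → ℝ)) (M : Set (Fin n → ℝ)) (ρ : (Fin n → ℝ) → ℂ)
    (φ : MvPolynomial (Fin n) ℂ) (k : ℕ) : ℂ :=
  ∫ τ in M, ρ τ * (evalReal φ τ ^ k / k.factorial) ∂μ

theorem coeff_expZY (V : Fin (d + 1) → ℝ) (c : ℂ) {m : Var d →₀ ℕ} {K : ℕ} (hK : m.degree < K) :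
    coeff m (expZY V c) = ∑ k ∈ Finset.range K, c ^ k / k.factorial * coeff m (zy V ^ k) := by
  rw [expZY, PowerSeries.coeff_subst (hasSubst_zy V c)]
  have h (k : ℕ) : PowerSeries.coeff k (PowerSeries.exp ℂ) • coeff m ((c • zy V) ^ k) =
      c ^ k / k.factorial * coeff m (zy V ^ k) := by
    rw [smul_pow, coeff_smul, PowerSeries.coeff_exp]
    simp
    ring
  simp_rw [h]
  refine finsum_eq_sum_of_support_subset _ fun k hk => ?_
  by_contra hk'
  rw [Finset.mem_coe, Finset.mem_range, not_lt] at hk'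
  exact hk (by simp [coeff_zy_pow_eq_zero V (hK.trans_le hk')])

variable {n : ℕ} {μ : Measure (Fin n → ℝ)} {M : Set (Fin n → ℝ)} {ρ : (Fin n → ℝ) → ℂ}

theorem integrableOn_mul_continuous (hM : IsCompact M) (hρ : IntegrableOn ρ M μ)
    {ψ : (Fin n → ℝ) → ℂ} (hψ : Continuous ψ) : IntegrableOn (fun τ => ρ τ * ψ τ) M μ :=
  hρ.mul_continuousOn hψ.continuousOn hM

theorem continuous_evalReal_pow_div (φ : MvPolynomial (Fin n) ℂ) (k : ℕ) :
    Continuous fun τ => evalReal φ τ ^ k / (k.factorial : ℂ) :=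
  ((continuous_evalReal φ).pow k).div_const _

theorem coeff_integralExp (V : Fin (d + 1) → ℝ) (φ : MvPolynomial (Fin n) ℂ) (m : Var d →₀ ℕ) :
    coeff m (integralExp V μ M ρ φ) =
      ∫ τ in M, ρ τ * coeff m (expZY V (evalReal φ τ)) ∂μ := rfl

theorem integralExp_eq_powSum (V : Fin (d + 1) → ℝ) (hM : IsCompact M) (hρ : IntegrableOn ρ M μ)
    (φ : MvPolynomial (Fin n) ℂ) :
    integralExp V μ M ρ φ = powSum V (expMoment μ M ρ φ) := by
  ext m
  rw [coeff_integralExp, coeff_powSum]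
  simp_rw [coeff_expZY V _ (Nat.lt_succ_self m.degree), Finset.mul_sum, ← mul_assoc]
  rw [integral_finsetSum]
  · simp_rw [integral_mul_const]
    rfl
  · intro k _
    exact (integrableOn_mul_continuous hM hρ (continuous_evalReal_pow_div φ k)).mul_const _

theorem shiftSeq_expMoment (φ : MvPolynomial (Fin n) ℂ) :
    shiftSeq (expMoment μ M ρ φ) = expMoment μ M (fun τ => ρ τ * evalReal φ τ) φ := by
  ext k
  rw [shiftSeq, expMoment, expMoment, ← integral_const_mul]
  refine integral_congr_ae (Filter.Eventually.of_forall fun τ => ?_)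
  have h1 : (k.factorial : ℂ) ≠ 0 := by exact_mod_cast k.factorial_ne_zero
  have h2 : (k + 1 : ℂ) ≠ 0 := Nat.cast_add_one_ne_zero k
  simp only [Nat.factorial_succ]
  push_cast
  field_simp
  ring

theorem expMoment_add_shiftSeq (hM : IsCompact M) (hρ : IntegrableOn ρ M μ)
    (φ : MvPolynomial (Fin n) ℂ) : expMoment μ M ρ φ + shiftSeq (expMoment μ M ρ φ) =
      expMoment μ M (fun τ => ρ τ * (1 + evalReal φ τ)) φ := by
  rw [shiftSeq_expMoment]
  ext k
  rw [Pi.add_apply, expMoment, expMoment, expMoment, ← integral_add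
    (integrableOn_mul_continuous hM hρ (continuous_evalReal_pow_div φ k))
    (integrableOn_mul_continuous hM
      (integrableOn_mul_continuous hM hρ (continuous_evalReal φ))
      (continuous_evalReal_pow_div φ k))]
  refine integral_congr_ae (Filter.Eventually.of_forall fun τ => ?_)
  simp only
  ring

/-- Since `F' = φ F` under the integral, each step multiplies the density by `1 + φ`. -/
theorem iterate_add_shiftSeq_expMoment (hM : IsCompact M) (hρ : IntegrableOn ρ M μ)
    (φ : MvPolynomial (Fin n) ℂ) (k : ℕ) :
    (fun b => b + shiftSeq b)^[k] (expMoment μ M ρ φ) =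
      expMoment μ M (fun τ => ρ τ * (1 + evalReal φ τ) ^ k) φ := by
  induction k with
  | zero => simp
  | succ k ih =>
    have hc : Continuous fun τ => (1 + evalReal φ τ) ^ k :=
      (continuous_const.add (continuous_evalReal φ)).pow k
    rw [Function.iterate_succ_apply', ih,
      expMoment_add_shiftSeq hM (integrableOn_mul_continuous hM hρ hc)]
    simp only [mul_assoc, pow_succ]

theorem sum_range_exp_mul_exp (c : ℕ → ℂ) (x y : ℂ) {K : ℕ} (hc : ∀ N, K ≤ N → c N = 0) :
    ∑ k ∈ Finset.range K, ∑ j ∈ Finset.range K,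
      x ^ k / k.factorial * (y ^ j / j.factorial) * c (k + j) =
    ∑ N ∈ Finset.range K, (x + y) ^ N / N.factorial * c N := by
  have h1 (N : ℕ) : (x + y) ^ N / N.factorial * c N = ∑ k ∈ Finset.range (N + 1),
      x ^ k / k.factorial * (y ^ (N - k) / (N - k).factorial) * c (k + (N - k)) := by
    rw [add_pow, Finset.sum_div, Finset.sum_mul]
    refine Finset.sum_congr rfl fun k hk => ?_
    have hkN : k ≤ N := Nat.lt_succ_iff.1 (Finset.mem_range.1 hk)
    have h2 := Nat.choose_mul_factorial_mul_factorial hkN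
    have hN : (N.factorial : ℂ) ≠ 0 := by exact_mod_cast N.factorial_ne_zero
    have hk' : (k.factorial : ℂ) ≠ 0 := by exact_mod_cast k.factorial_ne_zero
    have hNk : ((N - k).factorial : ℂ) ≠ 0 := by exact_mod_cast (N - k).factorial_ne_zero
    rw [Nat.add_sub_cancel' hkN, ← h2]
    have hch : ((N.choose k : ℕ) : ℂ) ≠ 0 := by
      exact_mod_cast (Nat.choose_pos hkN).ne'
    push_cast
    field_simp
  simp_rw [h1]
  -- The binomial expansion sums over the triangle `k + j < K`; the rest of the square contributes
  -- nothing by `hc`.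
  rw [Finset.sum_range_diag_flip K fun k j =>
    x ^ k / k.factorial * (y ^ j / j.factorial) * c (k + j)]
  refine Finset.sum_congr rfl fun k _ => ?_
  symm
  refine Finset.sum_subset (Finset.range_mono (Nat.sub_le _ _)) fun j _ hj => ?_
  rw [Finset.mem_range, not_lt] at hj
  rw [hc _ (by omega), mul_zero]

/-- The star product of two integrals of exponentials. -/
theorem isElementary_integralExp_starMul {V : Fin (d + 1) → ℝ}
    (hV : ∑ A, eta d A * V A * V A = 1) [IsLocallyFiniteMeasure μ] (hM : IsCompact M)
    (hρ : IntegrableOn ρ M μ) (φ : MvPolynomial (Fin n) ℂ)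
    {n' : ℕ} {μ' : Measure (Fin n' → ℝ)} {M' : Set (Fin n' → ℝ)} {ρ' : (Fin n' → ℝ) → ℂ}
    [IsLocallyFiniteMeasure μ'] (hM' : IsCompact M') (hρ' : IntegrableOn ρ' M' μ')
    (φ' : MvPolynomial (Fin n') ℂ) :
    IsElementary V (starMul (integralExp V μ M ρ φ) (integralExp V μ' M' ρ' φ')) := by
  let e := Fin.appendHomeomorph (X := ℝ) n n'
  -- Both restrictions are finite measures, so the image of their product on `ℝ^(n + n')` is finite,
  -- hence locally finite.
  let ν := (μ.restrict M).prod (μ'.restrict M')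
  have : IsFiniteMeasure (μ.restrict M) := ⟨by simpa using hM.measure_lt_top⟩
  have : IsFiniteMeasure (μ'.restrict M') := ⟨by simpa using hM'.measure_lt_top⟩
  have hν : ν.restrict (M ×ˢ M') = ν := by
    simp only [ν]
    rw [← Measure.prod_restrict, Measure.restrict_restrict hM.measurableSet,
      Measure.restrict_restrict hM'.measurableSet, Set.inter_self, Set.inter_self]
  have he : MeasurableEmbedding e := e.measurableEmbedding
  have hpre : e ⁻¹' (e '' (M ×ˢ M')) = M ×ˢ M' := Set.preimage_image_eq _ e.injective
  let ρ'' : (Fin (n + n') → ℝ) → ℂ := fun τ => ρ (e.symm τ).1 * ρ' (e.symm τ).2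
  let φ₁ : MvPolynomial (Fin (n + n')) ℂ := MvPolynomial.rename (Fin.castAdd n') φ
  let φ₂ : MvPolynomial (Fin (n + n')) ℂ := MvPolynomial.rename (Fin.natAdd n) φ'
  have hφ (p : (Fin n → ℝ) × (Fin n' → ℝ)) : evalReal (φ₂ * (1 + φ₁) + φ₁) (e p) =
      evalReal φ' p.2 * (1 + evalReal φ p.1) + evalReal φ p.1 := by
    have h1 : evalReal φ₁ (e p) = evalReal φ p.1 := by
      simp only [evalReal, φ₁, MvPolynomial.eval_rename]
      congr 2
      ext i
      simp [e]
    have h2 : evalReal φ₂ (e p) = evalReal φ' p.2 := by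
      simp only [evalReal, φ₂, MvPolynomial.eval_rename]
      congr 2
      ext i
      simp [e]
    rw [← h1, ← h2]
    simp [evalReal]
  -- The phase is `φ'(1 + φ) + φ`: each `zy` of the second exponential acquires a factor `1 + φ` on
  -- passing the first.
  refine ⟨n + n', ν.map e, e '' (M ×ˢ M'), ρ'', φ₂ * (1 + φ₁) + φ₁, 1, inferInstance,
    (hM.prod hM').image e.continuous, ?_, ?_⟩
  · rw [he.integrableOn_map_iff, hpre, IntegrableOn, hν]
    simpa [ρ'', Function.comp_def] using Integrable.mul_prod hρ hρ'
  · rw [MvPolynomial.coe_one, one_mul]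
    ext m
    rw [integralExp_eq_powSum V hM hρ, integralExp_eq_powSum V hM' hρ']
    obtain ⟨K, hK, hcoeff⟩ := coeff_powSum_starMul_powSum hV (expMoment μ M ρ φ)
      (expMoment μ' M' ρ' φ') m
    rw [hcoeff, coeff_integralExp, he.setIntegral_map, hpre, hν]
    have hint (k j : ℕ) : Integrable (fun p : (Fin n → ℝ) × (Fin n' → ℝ) =>
        (ρ p.1 * (1 + evalReal φ p.1) ^ k * (evalReal φ p.1 ^ j / j.factorial)) *
          (ρ' p.2 * (evalReal φ' p.2 ^ k / k.factorial))) ν :=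
      Integrable.mul_prod
        (f := fun x => ρ x * (1 + evalReal φ x) ^ k * (evalReal φ x ^ j / j.factorial))
        (g := fun y => ρ' y * (evalReal φ' y ^ k / k.factorial))
        (integrableOn_mul_continuous hM (integrableOn_mul_continuous hM hρ
          ((continuous_const.add (continuous_evalReal φ)).pow k))
          (continuous_evalReal_pow_div φ j))
        (integrableOn_mul_continuous hM' hρ' (continuous_evalReal_pow_div φ' k))
    have hterm (k j : ℕ) : expMoment μ' M' ρ' φ' k *
        (fun b => b + shiftSeq b)^[k] (expMoment μ M ρ φ) j =
        ∫ p, (ρ p.1 * (1 + evalReal φ p.1) ^ k * (evalReal φ p.1 ^ j / j.factorial)) *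
          (ρ' p.2 * (evalReal φ' p.2 ^ k / k.factorial)) ∂ν := by
      rw [iterate_add_shiftSeq_expMoment hM hρ, mul_comm]
      exact (integral_prod_mul _ _).symm
    simp_rw [hterm, ← integral_mul_const]
    rw [Finset.sum_congr rfl fun k _ => (integral_finsetSum _ fun j _ =>
      (hint k j).mul_const _).symm, ← integral_finsetSum _ fun k _ =>
        integrable_finsetSum _ fun j _ => (hint k j).mul_const _]
    refine integral_congr_ae (Filter.Eventually.of_forall fun p => ?_)
    simp only [hφ]
    rw [coeff_expZY V _ hK, ← sum_range_exp_mul_exp (fun N => coeff m (zy V ^ N)) _ _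
      fun N hN => coeff_zy_pow_eq_zero V (hK.trans_le hN)]
    simp only [ρ'', Homeomorph.symm_apply_apply, Finset.mul_sum, mul_pow]
    refine Finset.sum_congr rfl fun k _ => Finset.sum_congr rfl fun j _ => ?_
    ring

/-! ### Closure of the regular functions under the star product -/

theorem IsElementary.mem_regular {V : Fin (d + 1) → ℝ} {f : Series d} (h : IsElementary V f) :
    f ∈ regular V := Submodule.subset_span h

theorem coe_mul_mem_regular {V : Fin (d + 1) → ℝ} (P : MvPolynomial (Var d) ℂ) {f : Series d}
    (hf : f ∈ regular V) : (P : Series d) * f ∈ regular V := by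
  induction hf using Submodule.span_induction with
  | mem f hf =>
    obtain ⟨n, μ, M, ρ, φ, Q, hμ, hM, hρ, rfl⟩ := hf
    refine IsElementary.mem_regular ⟨n, μ, M, ρ, φ, P * Q, hμ, hM, hρ, ?_⟩
    rw [MvPolynomial.coe_mul, mul_assoc]
  | zero => simp
  | add f g _ _ hf hg => rw [mul_add]; exact add_mem hf hg
  | smul c f _ hf => rw [mul_smul_comm]; exact Submodule.smul_mem _ c hf

theorem X_mul_mem_regular {V : Fin (d + 1) → ℝ} (v : Var d) {f : Series d}
    (hf : f ∈ regular V) : X v * f ∈ regular V := by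
  simpa using coe_mul_mem_regular (MvPolynomial.X v) hf

theorem one_mem_regular (V : Fin (d + 1) → ℝ) : (1 : Series d) ∈ regular V := by
  -- A unit point mass on `ℝ^0` with zero phase gives `exp 0 = 1`.
  refine IsElementary.mem_regular ⟨0, Measure.dirac 0, Set.univ, fun _ => 1, 0, 1, inferInstance,
    isCompact_univ, ?_, ?_⟩
  · exact (integrable_const (1 : ℂ)).integrableOn
  · rw [MvPolynomial.coe_one, one_mul]
    ext m
    rw [coeff_integralExp, Measure.restrict_univ, integral_dirac, one_mul,
      coeff_expZY V _ (Nat.lt_succ_self m.degree), Finset.sum_range_succ']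
    simp [evalReal]

theorem coe_mem_regular (V : Fin (d + 1) → ℝ) (P : MvPolynomial (Var d) ℂ) :
    (P : Series d) ∈ regular V := by
  simpa using coe_mul_mem_regular P (one_mem_regular V)

theorem banded_integralExp (V : Fin (d + 1) → ℝ) (hM : IsCompact M) (hρ : IntegrableOn ρ M μ)
    (φ : MvPolynomial (Fin n) ℂ) : Banded (integralExp V μ M ρ φ) := by
  rw [integralExp_eq_powSum V hM hρ]
  exact banded_powSum V _

theorem banded_of_mem_regular {V : Fin (d + 1) → ℝ} {f : Series d} (hf : f ∈ regular V) :
    Banded f := by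
  induction hf using Submodule.span_induction with
  | mem f hf =>
    obtain ⟨n, μ, M, ρ, φ, Q, hμ, hM, hρ, rfl⟩ := hf
    exact (Banded.coe Q).mul (banded_integralExp V hM hρ φ)
  | zero => exact Banded.zero
  | add f g _ _ hf hg => exact hf.add hg
  | smul c f _ hf => exact hf.smul c

theorem derivation_integralExp (V : Fin (d + 1) → ℝ) (hM : IsCompact M)
    (hρ : IntegrableOn ρ M μ) (φ : MvPolynomial (Fin n) ℂ)
    {D : Derivation ℂ (Series d) (Series d)} (hD : IsLocal D) :
    D (integralExp V μ M ρ φ) =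
      D (zy V) * integralExp V μ M (fun τ => ρ τ * evalReal φ τ) φ := by
  rw [integralExp_eq_powSum V hM hρ, derivation_powSum V D hD, shiftSeq_expMoment,
    integralExp_eq_powSum V hM (integrableOn_mul_continuous hM hρ (continuous_evalReal φ))]

theorem qVec_mul_mem_regular {V : Fin (d + 1) → ℝ} (i : Fin 2) {f : Series d}
    (hf : f ∈ regular V) : qVec V i * f ∈ regular V := by
  rw [qVec, Finset.sum_mul]
  refine Submodule.sum_mem _ fun A _ => ?_
  rw [smul_mul_assoc, sub_mul]
  exact Submodule.smul_mem _ _ (sub_mem (X_mul_mem_regular _ hf) (X_mul_mem_regular _ hf))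

variable {n' : ℕ} {μ' : Measure (Fin n' → ℝ)} {M' : Set (Fin n' → ℝ)}

theorem integralExp_starMul_mem_regular {V : Fin (d + 1) → ℝ}
    (hV : ∑ A, eta d A * V A * V A = 1) [IsLocallyFiniteMeasure μ] (hM : IsCompact M)
    (hρ : IntegrableOn ρ M μ) (φ : MvPolynomial (Fin n) ℂ) [IsLocallyFiniteMeasure μ']
    (hM' : IsCompact M') {ρ' : (Fin n' → ℝ) → ℂ} (hρ' : IntegrableOn ρ' M' μ')
    (φ' : MvPolynomial (Fin n') ℂ) (P : MvPolynomial (Var d) ℂ) :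
    starMul (integralExp V μ M ρ φ) ((P : Series d) * integralExp V μ' M' ρ' φ') ∈
      regular V := by
  -- The density must vary: the derivative in the contraction term replaces `ρ` by `ρ φ`.
  induction P using MvPolynomial.induction_on generalizing ρ with
  | C c =>
    rw [coe_C_eq_smul_one, smul_mul_assoc, one_mul, starMul_smul_right]
    exact Submodule.smul_mem _ _
      (isElementary_integralExp_starMul hV hM hρ φ hM' hρ' φ').mem_regular
  | add P Q hP hQ =>
    rw [MvPolynomial.coe_add, add_mul,
      (banded_integralExp V hM hρ φ).isLocal_starMul_left.map_add]
    exact add_mem (hP hρ) (hQ hρ)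
  | mul_X P v hP =>
    have hρφ := integrableOn_mul_continuous hM hρ (continuous_evalReal φ)
    rw [mul_comm P, MvPolynomial.coe_mul, MvPolynomial.coe_X, mul_assoc,
      (banded_integralExp V hM hρ φ).starMul_mul_X,
      derivation_integralExp V hM hρ φ (isLocal_derivP _), derivP_zy, smul_mul_assoc,
      starMul_smul_left, (banded_integralExp V hM hρφ φ).qVec_mul_starMul
        ((Banded.coe P).mul (banded_integralExp V hM' hρ' φ'))]
    exact add_mem (X_mul_mem_regular _ (hP hρ)) (Submodule.smul_mem _ _
      (Submodule.smul_mem _ _ (qVec_mul_mem_regular _ (hP hρφ))))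

theorem elementary_starMul_mem_regular {V : Fin (d + 1) → ℝ}
    (hV : ∑ A, eta d A * V A * V A = 1) [IsLocallyFiniteMeasure μ] (hM : IsCompact M)
    (hρ : IntegrableOn ρ M μ) (φ : MvPolynomial (Fin n) ℂ) [IsLocallyFiniteMeasure μ']
    (hM' : IsCompact M') {ρ' : (Fin n' → ℝ) → ℂ} (hρ' : IntegrableOn ρ' M' μ')
    (φ' : MvPolynomial (Fin n') ℂ) (P Q : MvPolynomial (Var d) ℂ) :
    starMul ((P : Series d) * integralExp V μ M ρ φ)
      ((Q : Series d) * integralExp V μ' M' ρ' φ') ∈ regular V := by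
  -- A contraction differentiates the whole right factor, changing its prefactor `Q` as well as its
  -- density.
  induction P using MvPolynomial.induction_on generalizing Q ρ' with
  | C c =>
    rw [coe_C_eq_smul_one, smul_mul_assoc, one_mul, starMul_smul_left]
    exact Submodule.smul_mem _ _ (integralExp_starMul_mem_regular hV hM hρ φ hM' hρ' φ' Q)
  | add P P' hP hP' =>
    rw [MvPolynomial.coe_add, add_mul, ((Banded.coe Q).mul
      (banded_integralExp V hM' hρ' φ')).isLocal_starMul_right.map_add]
    exact add_mem (hP hρ' Q) (hP' hρ' Q)
  | mul_X P v hP =>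
    have hρφ := integrableOn_mul_continuous hM' hρ' (continuous_evalReal φ')
    have hb := (Banded.coe P).mul (banded_integralExp V hM hρ φ)
    rw [mul_comm P, MvPolynomial.coe_mul, MvPolynomial.coe_X, mul_assoc, hb.starMul_X_mul,
      Derivation.leibniz, derivation_integralExp V hM' hρ' φ' (isLocal_derivM _), ← coe_polyZY,
      derivM_coe, derivM_coe, smul_eq_mul, smul_eq_mul, ← mul_assoc, ← MvPolynomial.coe_mul,
      mul_comm (integralExp V μ' M' ρ' φ'), hb.isLocal_starMul_left.map_add]
    exact add_mem (X_mul_mem_regular _ (hP hρ' Q))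
      (Submodule.smul_mem _ _ (add_mem (hP hρφ _) (hP hρ' _)))

/-- Regular functions are closed under the star product. -/
theorem starMul_mem_regular {V : Fin (d + 1) → ℝ} (hV : ∑ A, eta d A * V A * V A = 1)
    {f g : Series d} (hf : f ∈ regular V) (hg : g ∈ regular V) : starMul f g ∈ regular V := by
  have hbg := (banded_of_mem_regular hg).isLocal_starMul_right
  induction hf using Submodule.span_induction with
  | mem f hf =>
    have hbf := (banded_of_mem_regular (IsElementary.mem_regular hf)).isLocal_starMul_left
    obtain ⟨n, μ, M, ρ, φ, P, hμ, hM, hρ, rfl⟩ := hf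
    clear hbg
    induction hg using Submodule.span_induction with
    | mem g hg =>
      obtain ⟨n', μ', M', ρ', φ', Q, hμ', hM', hρ', rfl⟩ := hg
      exact elementary_starMul_mem_regular hV hM hρ φ hM' hρ' φ' P Q
    | zero => rw [hbf.map_zero]; exact zero_mem _
    | add g g' _ _ hg hg' => rw [hbf.map_add]; exact add_mem hg hg'
    | smul c g _ hg => rw [hbf.map_smul]; exact Submodule.smul_mem _ c hg
  | zero => rw [hbg.map_zero]; exact zero_mem _
  | add f f' _ _ hf hf' => rw [hbg.map_add]; exact add_mem hf hf'
  | smul c f _ hf => rw [hbg.map_smul]; exact Submodule.smul_mem _ c hf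

end HSStar

end

/-! ### The bimodule theorem -/

theorem mainTheorem2 (d : ℕ) (V : Fin (d + 1) → ℝ) (hV : ∑ A, HSStar.eta d A * V A * V A = 1) :
    -- star products of power series with regular functions are well defined
    (∀ f : HSStar.Series d, ∀ g ∈ HSStar.regular V,
      HSStar.StarDefined f g ∧ HSStar.StarDefined g f) ∧
    -- the regular functions form a unital associative algebra
    (1 : HSStar.Series d) ∈ HSStar.regular V ∧
    (∀ g ∈ HSStar.regular V, ∀ h ∈ HSStar.regular V, HSStar.starMul g h ∈ HSStar.regular V) ∧
    (∀ g ∈ HSStar.regular V, ∀ h ∈ HSStar.regular V, ∀ k ∈ HSStar.regular V,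
      HSStar.starMul (HSStar.starMul g h) k = HSStar.starMul g (HSStar.starMul h k)) ∧
    -- both actions are bilinear
    (∀ f f' : HSStar.Series d, ∀ g ∈ HSStar.regular V, ∀ g' ∈ HSStar.regular V, ∀ c : ℂ,
      HSStar.starMul g (f + f') = HSStar.starMul g f + HSStar.starMul g f' ∧
      HSStar.starMul (g + g') f = HSStar.starMul g f + HSStar.starMul g' f ∧
      HSStar.starMul (f + f') g = HSStar.starMul f g + HSStar.starMul f' g ∧
      HSStar.starMul f (g + g') = HSStar.starMul f g + HSStar.starMul f g' ∧
      HSStar.starMul (c • g) f = c • HSStar.starMul g f ∧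
      HSStar.starMul g (c • f) = c • HSStar.starMul g f ∧
      HSStar.starMul (c • f) g = c • HSStar.starMul f g ∧
      HSStar.starMul f (c • g) = c • HSStar.starMul f g) ∧
    -- both actions are unital
    (∀ f : HSStar.Series d, HSStar.starMul 1 f = f ∧ HSStar.starMul f 1 = f) ∧
    -- left module, right module, and commuting actions
    (∀ f : HSStar.Series d, ∀ g ∈ HSStar.regular V, ∀ h ∈ HSStar.regular V,
      HSStar.starMul (HSStar.starMul g h) f = HSStar.starMul g (HSStar.starMul h f) ∧
      HSStar.starMul f (HSStar.starMul g h) = HSStar.starMul (HSStar.starMul f g) h ∧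
      HSStar.starMul (HSStar.starMul g f) h = HSStar.starMul g (HSStar.starMul f h)) := by
  refine ⟨fun f g hg => ?_, HSStar.one_mem_regular V,
    fun g hg h hh => HSStar.starMul_mem_regular hV hg hh, fun g hg h hh k hk => ?_,
    fun f f' g hg g' hg' c => ?_, fun f => ⟨HSStar.one_starMul f, HSStar.starMul_one f⟩,
    fun f g hg h hh => ?_⟩
  · have hb := HSStar.banded_of_mem_regular hg
    exact ⟨hb.starDefined_right f, hb.starDefined_left f⟩
  · exact (HSStar.banded_of_mem_regular hh).starMul_assoc_of_right
      (HSStar.banded_of_mem_regular hk)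
      (HSStar.banded_of_mem_regular (HSStar.starMul_mem_regular hV hh hk)) g
  · have hb := HSStar.banded_of_mem_regular hg
    have hb' := HSStar.banded_of_mem_regular hg'
    exact ⟨hb.isLocal_starMul_left.map_add f f',
      HSStar.starMul_add_left (hb.starDefined_left f) (hb'.starDefined_left f),
      hb.isLocal_starMul_right.map_add f f',
      HSStar.starMul_add_right (hb.starDefined_right f) (hb'.starDefined_right f),
      HSStar.starMul_smul_left c g f, HSStar.starMul_smul_right c g f,
      HSStar.starMul_smul_left c f g, HSStar.starMul_smul_right c f g⟩
  · have hbg := HSStar.banded_of_mem_regular hg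
    have hbh := HSStar.banded_of_mem_regular hh
    have hgh := HSStar.banded_of_mem_regular (HSStar.starMul_mem_regular hV hg hh)
    -- With `f` on the right, bandedness of `h * p` comes from closure, polynomials being regular.
    -- With `f` in the middle, bandedness of `p * h` is automatic.
    exact ⟨hbg.starMul_assoc_of_left hbh hgh (fun p => HSStar.banded_of_mem_regular
        (HSStar.starMul_mem_regular hV hh (HSStar.coe_mem_regular V p))) f,
      (hbg.starMul_assoc_of_right hbh hgh f).symm,
      hbg.starMul_assoc_of_outer hbh (fun p => hbh.coe_starMul p) f⟩
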